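/- Let $M$ be a finite monoid with set of idempotents $E(M)$. Idempotents $e,f$ are conjugate if $e=ab$ and $f=ba$ for some $a,b\in M$; assume that $M\in\mathbf{DG}$, i.e. that every conjugacy class of idempotents of $M$ is a singleton. For $e\in E(M)$ let $G_e$ be the maximal subgroup at $e$, that is, the group of units of the monoid $eMe$. Let $k$ be a field such that, for every $e\in E(M)$, $k$ is a splitting field for $G_e$ (i.e. $kG_e/\mathrm{rad}(kG_e)$ is a product of matrix algebras over $k$) and the characteristic of $k$ does not divide $|G_e|$. For a group $G$ let $\mathrm{Irr}(G)$ be the set of isomorphism classes of simple $kG$-modules. The Karoubi envelope $\mathscr K(M)$ is the category with object set $E(M)$, with $\mathscr K(M)(e,f)=fMe$, and with composition given by multiplication in $M$. A morphism $m$ of a category is irreducible if it is neither a split monomorphism nor a split epimorphism, and whenever $m=gh$, either $h$ is a split monomorphism or $g$ is a split epimorphism. Let $\mathsf{Irr}_{\mathscr K(M)}(e,f)$ be the set of irreducible morphisms from $e$ to $f$; the group $G_f\times G_e$ acts on it by $(g,h)\cdot m=gmh^{-1}$. The quiver $Q(A)$ of a finite dimensional $k$-algebra $A$ that splits over $k$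 (i.e. $A/\mathrm{rad}(A)$ is a product of matrix algebras over $k$) has as vertices the isomorphism classes of simple left $A$-modules, and the number of arrows from $S$ to $T$ is $\dim_k\mathrm{Ext}^1_A(S,T)$. Then $kM$ splits over $k$, and the vertex set of $Q(kM)$ is the disjoint union $\coprod_{e\in E(M)}\mathrm{Irr}(G_e)$, where $U\in\mathrm{Irr}(G_e)$ corresponds to the simple $kM$-module with underlying space $U$ on which $m\in M$ acts as $eme\in G_e$ if $e\in MmM$, and as $0$ otherwise. If $U\in\mathrm{Irr}(G_e)$ and $V\in\mathrm{Irr}(G_f)$, then $V\otimes_kU^*$ (with $U^*$ the contragredient of $U$) is an irreducible $G_f\times G_e$-module, and the number of arrows from $U$ to $V$ in $Q(kM)$ is finite and equal to the multiplicity of $V\otimes_kU^*$ as an irreducible constituent of the permutation module $k[\mathsf{Irr}_{\mathscr K(M)}(e,f)]$ of $G_f\times G_e$. -/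

import Mathlib

open CategoryTheory CategoryTheory.Idempotents
open scoped MonoidAlgebra TensorProduct ModuleCat

universe u v w

noncomputable section

/-! ### Irreducible morphisms of a category -/

/-- A morphism `f` is irreducible (in the sense of Auslander and Reiten) if it is neither a split
monomorphism nor a split epimorphism, and in each factorization `f = g ∘ h` the morphism `h` is a
split monomorphism or the morphism `g` is a split epimorphism. -/
def IsIrreducibleMorphism {C : Type u} [Category.{v} C] {X Y : C} (f : X ⟶ Y) : Prop :=
  ¬ IsSplitMono f ∧ ¬ IsSplitEpi f ∧
    ∀ (Z : C) (h : X ⟶ Z) (g : Z ⟶ Y), f = h ≫ g → IsSplitMono h ∨ IsSplitEpi g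

/-- The set of irreducible morphisms from `X` to `Y`. -/
def IrrMor {C : Type u} [Category.{v} C] (X Y : C) : Type v :=
  {f : X ⟶ Y // IsIrreducibleMorphism f}

/-- Irreducibility is stable under composition with isomorphisms on both sides. -/
theorem IsIrreducibleMorphism.iso_comp_iso {C : Type u} [Category.{v} C] {X' X Y Y' : C}
    {f : X ⟶ Y} (hf : IsIrreducibleMorphism f) (a : X' ⟶ X) [IsIso a] (b : Y ⟶ Y') [IsIso b] :
    IsIrreducibleMorphism (a ≫ f ≫ b) := by
  obtain ⟨h1, h2, h3⟩ := hf
  refine ⟨fun h => h1 ?_, fun h => h2 ?_, fun Z p q hpq => ?_⟩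
  · have e : f = inv a ≫ (a ≫ f ≫ b) ≫ inv b := by simp
    rw [e]; infer_instance
  · have e : f = inv a ≫ (a ≫ f ≫ b) ≫ inv b := by simp
    rw [e]; infer_instance
  · have e : f = (inv a ≫ p) ≫ (q ≫ inv b) := by
      have : inv a ≫ (a ≫ f ≫ b) ≫ inv b = f := by simp
      rw [← this, hpq]; simp
    rcases h3 Z _ _ e with h | h
    · left
      have : p = a ≫ (inv a ≫ p) := by simp
      rw [this]; infer_instance
    · right
      have : q = (q ≫ inv b) ≫ b := by simp
      rw [this]; infer_instance

/-- The group `Aut(Y) × Aut(X)`, with `Aut` written as the group of units of the endomorphism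
monoid, acts on the irreducible morphisms `m : X ⟶ Y` by `(g, h) • m = g ∘ m ∘ h⁻¹`. -/
instance IrrMor.mulAction {C : Type u} [Category.{v} C] (X Y : C) :
    MulAction ((End Y)ˣ × (End X)ˣ) (IrrMor X Y) where
  smul p m := ⟨End.asHom (↑p.2⁻¹ : End X) ≫ m.1 ≫ End.asHom (↑p.1 : End Y),
    haveI : IsIso (End.asHom (↑p.2⁻¹ : End X)) := (isUnit_iff_isIso _).1 p.2⁻¹.isUnit
    haveI : IsIso (End.asHom (↑p.1 : End Y)) := (isUnit_iff_isIso _).1 p.1.isUnit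
    m.2.iso_comp_iso _ _⟩
  one_smul m := Subtype.ext <| by
    change 𝟙 X ≫ m.1 ≫ 𝟙 Y = m.1
    simp
  mul_smul p q m := Subtype.ext <| by
    change End.asHom (↑(p * q).2⁻¹ : End X) ≫ m.1 ≫ End.asHom (↑(p * q).1 : End Y) =
      End.asHom (↑p.2⁻¹ : End X) ≫ (End.asHom (↑q.2⁻¹ : End X) ≫ m.1 ≫
        End.asHom (↑q.1 : End Y)) ≫ End.asHom (↑p.1 : End Y)
    have h1 : End.asHom (↑(p * q).2⁻¹ : End X) =
        End.asHom (↑p.2⁻¹ : End X) ≫ End.asHom (↑q.2⁻¹ : End X) := by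
      rw [Prod.snd_mul, mul_inv_rev, Units.val_mul]; rfl
    have h2 : End.asHom (↑(p * q).1 : End Y) =
        End.asHom (↑q.1 : End Y) ≫ End.asHom (↑p.1 : End Y) := by
      rw [Prod.fst_mul, Units.val_mul]; rfl
    rw [h1, h2]
    simp only [Category.assoc]

/-! ### Idempotents, the Karoubi envelope and maximal subgroups of a monoid -/

/-- The set `E(M)` of idempotents of a monoid. -/
def Idem (M : Type v) [Monoid M] : Type v := {e : M // IsIdempotentElem e}

/-- Two idempotents `e`, `f` are conjugate if `e = a b` and `f = b a` for some `a`, `b`. -/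
def Idem.Conj {M : Type v} [Monoid M] (e f : Idem M) : Prop :=
  ∃ a b : M, a * b = e.1 ∧ b * a = f.1

/-- The class `DG`: every conjugacy class of idempotents is a singleton. (In particular each
conjugacy class of idempotents is a subsemigroup, that is, such a monoid is rectangular.) -/
def IsDG (M : Type v) [Monoid M] : Prop := ∀ e f : Idem M, e.Conj f → e = f

/-- The object `e` of the Karoubi envelope of `M`. Composition in `SingleObj M` is `x ≫ y = y * x`,
so that a morphism `e ⟶ f` of the Karoubi envelope is an element of `f M e`, the composition of
`n : e ⟶ e'` and `m : e' ⟶ f` is the product `m * n`, and the identity of `e` is `e`. -/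
def Idem.toKaroubi {M : Type v} [Monoid M] (e : Idem M) : Karoubi (SingleObj M) where
  X := SingleObj.star M
  p := e.1
  idem := e.2

/-- The maximal subgroup `G_e` at `e`: the group of units of the monoid `e M e`, which is the
endomorphism monoid of `e` in the Karoubi envelope. -/
abbrev Idem.maxSubgroup {M : Type v} [Monoid M] (e : Idem M) : Type v := (End e.toKaroubi)ˣ

/-- The element of `M` underlying an element of the maximal subgroup `G_e`. -/
def Idem.coeMaxSubgroup {M : Type v} [Monoid M] {e : Idem M} (g : e.maxSubgroup) : M :=
  (End.asHom (g : End e.toKaroubi)).f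

/-! ### Simple modules, splitting fields, Gabriel quiver -/

/-- The simple left `A`-modules. -/
def SimpleMod (A : Type w) [Ring A] : Type (w + 1) := {S : ModuleCat.{w} A // IsSimpleModule A S}

/-- Isomorphism of simple modules. -/
instance SimpleMod.setoid (A : Type w) [Ring A] : Setoid (SimpleMod A) where
  r S T := Nonempty (S.1 ≅ T.1)
  iseqv := ⟨fun _ => ⟨Iso.refl _⟩, fun ⟨i⟩ => ⟨i.symm⟩, fun ⟨i⟩ ⟨j⟩ => ⟨i ≪≫ j⟩⟩

/-- The set of isomorphism classes of simple left `A`-modules. For `A = k[G]` this is the set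
`Irr(G)` of equivalence classes of irreducible representations of `G` over `k`. -/
def IrrClass (A : Type w) [Ring A] : Type (w + 1) := Quotient (SimpleMod.setoid A)

/-- The isomorphism class of a simple module. -/
def SimpleMod.cls {A : Type w} [Ring A] (S : SimpleMod A) : IrrClass A :=
  Quotient.mk (SimpleMod.setoid A) S

/-- A `k`-algebra `A` splits over `k` if `A / rad(A)` is a product of matrix algebras over `k`. -/
def SplitsOver (k : Type u) [Field k] (A : Type w) [Ring A] [Algebra k A] : Prop :=
  ∃ (n : ℕ) (d : Fin n → ℕ),
    Nonempty ((A ⧸ Ring.jacobson A) ≃ₐ[k] (∀ i, Matrix (Fin (d i)) (Fin (d i)) k))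

/-- The (vertex set of the) Gabriel quiver `Q(A)` of a finite dimensional `k`-algebra `A`: its
vertices are the isomorphism classes of simple left `A`-modules. -/
def GabrielQuiver (k : Type u) [Field k] (A : Type w) [Ring A] [Algebra k A] : Type (w + 1) :=
  IrrClass A

/-- The arrows `S ⟶ T` of the Gabriel quiver are indexed by a `k`-basis of `Ext¹_A(S, T)`, so that
their number is its dimension. -/
instance GabrielQuiver.quiver (k : Type u) [Field k] (A : Type w) [Ring A] [Algebra k A] :
    Quiver.{w} (GabrielQuiver k A) where
  Hom S T := Module.Free.ChooseBasisIndex k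
    (Abelian.Ext (Quotient.out (s := SimpleMod.setoid A) S).1
      (Quotient.out (s := SimpleMod.setoid A) T).1 1)

open Classical in
/-- The multiplicity of a simple module `S` as an irreducible constituent of a module `N` of finite
length: the number of factors isomorphic to `S` in a composition series of `N` (by the
Jordan–Hölder theorem it does not depend on the composition series). -/
def constituentMultiplicity (A : Type w) [Ring A] (S : Type*) [AddCommGroup S] [Module A S]
    (N : Type*) [AddCommGroup N] [Module A N] : ℕ :=
  if h : ∃ s : CompositionSeries (Submodule A N), s.head = ⊥ ∧ s.last = ⊤ then
    Nat.card {i : Fin h.choose.length //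
      Nonempty (((h.choose i.succ) ⧸ (h.choose i.castSucc).submoduleOf (h.choose i.succ)) ≃ₗ[A] S)}
  else 0

/-! ### The representations that occur in the result -/

/-- The representation of a group or monoid on a simple `k[G]`-module. -/
abbrev SimpleMod.rep {k : Type u} [Field k] {G : Type v} [Monoid G] (U : SimpleMod k[G]) :
    Representation k G U.1 :=
  Representation.ofModule' (k := k) (G := G) U.1

/-- The `H × G`-module `V ⊗ U*`, where `U*` is the contragredient of the `G`-module `U`. -/
def tensorDual {k : Type u} [Field k] {H G : Type v} [Group H] [Group G]
    {V U : Type*} [AddCommGroup V] [Module k V] [AddCommGroup U] [Module k U]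
    (ρ : Representation k H V) (τ : Representation k G U) :
    Representation k (H × G) (V ⊗[k] Module.Dual k U) :=
  Representation.tprod (MonoidHom.comp ρ (MonoidHom.fst H G))
    (MonoidHom.comp τ.dual (MonoidHom.snd H G))

/-- The permutation module of `G_f × G_e` spanned by the irreducible morphisms from `e` to `f` in
the Karoubi envelope of `M`, with `(g, h) m = g m h⁻¹`. -/
def irrPermutationRep (k : Type u) [Field k] {M : Type v} [Monoid M] (e f : Idem M) :
    Representation k (f.maxSubgroup × e.maxSubgroup) k[IrrMor e.toKaroubi f.toKaroubi] :=
  Representation.ofMulAction k (f.maxSubgroup × e.maxSubgroup) (IrrMor e.toKaroubi f.toKaroubi)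

/-- The simple `k[M]`-module `S` is the inflation of the simple `k[G_e]`-module `U`: up to a linear
isomorphism, `m` acts on it as the element `e m e` of `G_e` acts on `U` if `e ∈ M m M`, and as zero
otherwise. -/
def IsInflation {k : Type u} [Field k] {M : Type v} [Monoid M] (e : Idem M)
    (U : SimpleMod k[e.maxSubgroup]) (S : SimpleMod k[M]) : Prop :=
  ∃ φ : S.1 ≃ₗ[k] U.1,
    ∀ m : M,
      ((∃ a b : M, a * m * b = e.1) →
        ∃ g : e.maxSubgroup, Idem.coeMaxSubgroup g = e.1 * m * e.1 ∧
          ∀ x, φ (S.rep m x) = U.rep g (φ x)) ∧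
      ((¬ ∃ a b : M, a * m * b = e.1) → ∀ x, S.rep m x = 0)

end

/-! Write `e ≤ m` when `e ∈ MmM` (`Idem.LeJ`). In a `DG` monoid, `xy = e` forces `yex = e`, because
`yex` is an idempotent conjugate to `e`. Hence, if `e ≤ m`, then `m` commutes with `e` and `em` is
invertible in `G_e`, and the `m` with `e ≤ m` form a submonoid. So `m ↦ eme` for `e ≤ m`, `m ↦ 0`
otherwise, extends to a surjection `kM → kG_e` (`apexHom`). The elements of `M` that annihilate a
given simple module form a prime ideal, which is `{m | e ≰ m}` for some `e`; so every simple module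
is inflated along one of these maps (`exists_isInflation`). Together they map `kM` onto `∏ kG_e`,
which is semisimple by Maschke, with kernel the radical; this gives the splitting and the vertices.

For the arrows, `Ext¹(S, T)` is the space of derivations `M → Hom_k(S, T)` modulo the inner ones.
Let `S`, `T` have apexes `e`, `f`. An irreducible morphism `e ⟶ f` is an `m ∈ fMe` with `e ≰ m` and
`f ≰ m` that is not a product `gh` with `f ≰ g` and `e ≰ h`. In such a product `g` acts as zero on
`T` and `h` as zero on `S`, so the Leibniz rule makes every derivation vanish on `gh`. Modulo inner
derivations a derivation is thus determined by its values on the irreducible morphisms, where it is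
equivariant, and every equivariant function arises (`ker_restrictToIrr`,
`restrictToIrr_surjective`). The equivariant functions are the intertwiners from the permutation
module to `V ⊗ U*`, and since `V ⊗ U*` has only scalar endomorphisms, their dimension is the
multiplicity. -/

/-! ### Ideals and idempotents in a `DG` monoid -/

section MonoidLemmas

variable {M : Type v} [Monoid M]

/-- `e.LeJ m` means that the idempotent `e` lies in the two-sided ideal `M m M`. -/
def Idem.LeJ (e : Idem M) (m : M) : Prop := ∃ a b : M, a * m * b = e.1

namespace Idem

theorem mul_self (e : Idem M) : e.1 * e.1 = e.1 := e.2

theorem mul_self_assoc (e : Idem M) (x : M) : e.1 * (e.1 * x) = e.1 * x := by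
  rw [← mul_assoc, e.mul_self]

theorem LeJ.refl (e : Idem M) : e.LeJ e.1 := ⟨1, 1, by simp⟩

theorem LeJ.left {e : Idem M} {m n : M} (h : e.LeJ (m * n)) : e.LeJ m := by
  obtain ⟨a, b, h⟩ := h
  exact ⟨a, n * b, by simpa only [mul_assoc] using h⟩

theorem LeJ.right {e : Idem M} {m n : M} (h : e.LeJ (m * n)) : e.LeJ n := by
  obtain ⟨a, b, h⟩ := h
  exact ⟨a * m, b, by simpa only [mul_assoc] using h⟩

theorem LeJ.one (e : Idem M) : e.LeJ 1 := ⟨e.1, 1, by simp⟩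

variable (hM : IsDG M)
include hM

/-- If `xy = e`, then `yex` is an idempotent conjugate to `e` through `ex` and `ye`, so it equals
`e`. Applied to `(am)b = e` and to `a(mb) = e`, this makes `bea` a left and a right inverse of `m`
relative to `e`. -/
theorem LeJ.exists_inverse {e : Idem M} {m : M} (h : e.LeJ m) :
    e.1 * m = m * e.1 ∧
      ∃ c, e.1 * c = c ∧ c * e.1 = c ∧ m * c = e.1 ∧ c * m = e.1 := by
  obtain ⟨a, b, h⟩ := h
  have key : ∀ x y : M, x * y = e.1 → y * e.1 * x = e.1 := by
    intro x y hxy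
    have hid : IsIdempotentElem (y * e.1 * x) := by
      calc (y * e.1 * x) * (y * e.1 * x) = y * (e.1 * (x * y)) * e.1 * x := by
            simp only [mul_assoc]
        _ = y * e.1 * x := by rw [hxy, e.mul_self, mul_assoc y, e.mul_self]
    have := hM e ⟨_, hid⟩ ⟨e.1 * x, y * e.1, by
      rw [mul_assoc, ← mul_assoc x, hxy]; simp only [e.mul_self], by
      simp only [mul_assoc, e.mul_self_assoc]⟩
    exact (congrArg Subtype.val this).symm
  have h1 : b * e.1 * a * m = e.1 := by
    rw [mul_assoc]; exact key (a * m) b h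
  have h2 : m * (b * e.1 * a) = e.1 := by
    have := key a (m * b) (by rw [← mul_assoc]; exact h)
    simpa only [mul_assoc] using this
  generalize b * e.1 * a = c at h1 h2
  have h3 : e.1 * m = m * e.1 := by rw [← h1, ← mul_assoc, h2, h1]
  refine ⟨h3, e.1 * c * e.1, ?_, ?_, ?_, ?_⟩
  · simp only [mul_assoc, e.mul_self_assoc]
  · simp only [mul_assoc, e.mul_self]
  · rw [← mul_assoc, ← mul_assoc, ← h3, mul_assoc e.1, h2, e.mul_self, e.mul_self]
  · rw [mul_assoc, h3, ← mul_assoc, mul_assoc e.1, h1, e.mul_self, e.mul_self]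

theorem LeJ.comm {e : Idem M} {m : M} (h : e.LeJ m) : e.1 * m = m * e.1 :=
  (h.exists_inverse hM).1

/-- A left inverse of `m` and a right inverse of `n` relative to `e` reduce `mn` to `e`. This is
what makes `apexHom` multiplicative. -/
theorem LeJ.mul {e : Idem M} {m n : M} (hm : e.LeJ m) (hn : e.LeJ n) : e.LeJ (m * n) := by
  obtain ⟨_, c, h1, -, -, h3⟩ := hm.exists_inverse hM
  obtain ⟨h4, d, -, h5, h6, -⟩ := hn.exists_inverse hM
  refine ⟨c, d, ?_⟩
  rw [← mul_assoc, h3, mul_assoc, h6, e.mul_self]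

theorem LeJ.antisymm {e f : Idem M} (h : e.LeJ f.1) (h' : f.LeJ e.1) : e = f := by
  have h1 := h.comm hM
  obtain ⟨-, c, hc1, hc2, hc3, hc4⟩ := h.exists_inverse hM
  obtain ⟨-, d, hd1, hd2, hd3, hd4⟩ := h'.exists_inverse hM
  have h2 : f.1 * e.1 = e.1 := by rw [← hc3, ← mul_assoc, f.mul_self]
  have h3 : e.1 * f.1 = f.1 := by rw [← hd3, ← mul_assoc, e.mul_self]
  exact Subtype.ext (by rw [← h2, ← h1, h3])

theorem LeJ.mul_eq {e f : Idem M} (h : e.LeJ f.1) : f.1 * e.1 = e.1 ∧ e.1 * f.1 = e.1 := by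
  obtain ⟨h1, c, hc1, hc2, hc3, hc4⟩ := h.exists_inverse hM
  have h2 : f.1 * e.1 = e.1 := by rw [← hc3, ← mul_assoc, f.mul_self]
  exact ⟨h2, h1.trans h2⟩

end Idem

section Finite

variable [Finite M]

theorem exists_pow_isIdempotentElem (a : M) : ∃ n, 0 < n ∧ IsIdempotentElem (a ^ n) := by
  obtain ⟨i, j, hij, h⟩ : ∃ i j : ℕ, i < j ∧ a ^ i = a ^ j := by
    obtain ⟨i, j, hne, h⟩ := Finite.exists_ne_map_eq_of_infinite (fun n : ℕ => a ^ n)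
    rcases lt_or_gt_of_ne hne with h' | h'
    · exact ⟨i, j, h', h⟩
    · exact ⟨j, i, h', h.symm⟩
  obtain ⟨p, rfl⟩ := Nat.exists_eq_add_of_lt hij
  have step : ∀ t n, i ≤ n → a ^ (n + t * (p + 1)) = a ^ n := by
    intro t
    induction t with
    | zero => simp
    | succ t ih =>
      intro n hn
      obtain ⟨s, rfl⟩ := Nat.exists_eq_add_of_le hn
      have : i + s + (t + 1) * (p + 1) = (i + p + 1) + (s + t * (p + 1)) := by ring
      rw [this, pow_add, ← h, ← pow_add, ← add_assoc, ih _ (by omega)]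
  -- The exponent is a multiple of the period `p + 1` and is at least the preperiod `i`, so doubling
  -- it changes nothing.
  refine ⟨(i + 1) * (p + 1), by positivity, ?_⟩
  change _ * _ = _
  rw [← pow_add]
  exact step _ _ (by nlinarith)

/-- Choose `m ∉ K` with `MmM` minimal. Primeness gives `mxm ∉ K`, so minimality gives `m = a(mxm)b`,
and iteration gives `m = (amx)ⁿ m bⁿ`. An idempotent power of `amx` is therefore outside `K`. Any `k
∉ K` lies above it, by primeness and minimality once more. -/
theorem exists_idem_of_prime_ideal (K : Set M) (hK : K ≠ Set.univ)
    (hl : ∀ a, ∀ m ∈ K, a * m ∈ K) (hr : ∀ a, ∀ m ∈ K, m * a ∈ K)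
    (hp : ∀ a b, a ∉ K → b ∉ K → ∃ x, a * x * b ∉ K) :
    ∃ e : Idem M, ∀ m, m ∈ K ↔ ¬ e.LeJ m := by
  classical
  let J : M → Set M := fun m => {n | ∃ a b, a * m * b = n}
  obtain ⟨m, hm, hmin⟩ := (Set.toFinite Kᶜ).exists_minimalFor J _ (Set.nonempty_compl.2 hK)
  have hmin' : ∀ n, n ∉ K → (∃ a b, a * m * b = n) → ∃ a b, a * n * b = m := by
    rintro n hn ⟨a, b, rfl⟩
    have : J (a * m * b) ⊆ J m := by
      rintro _ ⟨c, d, rfl⟩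
      exact ⟨c * a, b * d, by simp only [mul_assoc]⟩
    exact hmin hn this (⟨1, 1, by simp⟩ : m ∈ J m)
  obtain ⟨x, hx⟩ := hp m m hm hm
  obtain ⟨a, b, hab⟩ := hmin' _ hx ⟨m * x, 1, by simp⟩
  have hpow : ∀ n, (a * m * x) ^ n * m * b ^ n = m := by
    intro n
    induction n with
    | zero => simp
    | succ n ih =>
      calc (a * m * x) ^ (n + 1) * m * b ^ (n + 1)
          = (a * m * x) ^ n * (a * (m * x * m) * b) * b ^ n := by
            rw [pow_succ, pow_succ']; simp only [mul_assoc]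
        _ = m := by rw [hab, ih]
  obtain ⟨n, hn, hid⟩ := exists_pow_isIdempotentElem (a * m * x)
  have heK : (a * m * x) ^ n ∉ K := fun h => hm <| by
    rw [← hpow n]; exact hr _ _ (hr _ _ h)
  obtain ⟨c, d, hcd⟩ : ∃ c d, c * m * d = (a * m * x) ^ n := by
    obtain ⟨n, rfl⟩ := Nat.exists_eq_succ_of_ne_zero hn.ne'
    exact ⟨(a * m * x) ^ n * a, x, by rw [pow_succ]; simp only [mul_assoc]⟩
  refine ⟨⟨_, hid⟩, fun k => ⟨fun hk ⟨p, q, hpq⟩ => heK ?_, fun h => ?_⟩⟩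
  · rw [← show p * k * q = (a * m * x) ^ n from hpq]
    exact hr _ _ (hl _ _ hk)
  · by_contra hk
    obtain ⟨y, hy⟩ := hp _ _ heK hk
    obtain ⟨p, q, hpq⟩ := hmin' _ hy ⟨c, d * y * k, by rw [← hcd]; simp only [mul_assoc]⟩
    refine h ⟨c * p * (a * m * x) ^ n * y, q * d, ?_⟩
    change _ = (a * m * x) ^ n
    calc _ = c * (p * ((a * m * x) ^ n * y * k) * q) * d := by simp only [mul_assoc]
      _ = _ := by rw [hpq, hcd]

end Finite

namespace Idem

theorem coeMaxSubgroup_mul {e : Idem M} (g h : e.maxSubgroup) :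
    coeMaxSubgroup (g * h) = coeMaxSubgroup g * coeMaxSubgroup h := rfl

theorem coeMaxSubgroup_one {e : Idem M} : coeMaxSubgroup (1 : e.maxSubgroup) = e.1 := rfl

theorem coeMaxSubgroup_injective {e : Idem M} :
    Function.Injective (coeMaxSubgroup : e.maxSubgroup → M) := fun _ _ h =>
  Units.ext (Karoubi.hom_ext _ _ h)

theorem karoubi_mul_hom {e f : Idem M} (m : e.toKaroubi ⟶ f.toKaroubi) :
    f.1 * (show M from m.f) = m.f :=
  Karoubi.comp_p m

theorem karoubi_hom_mul {e f : Idem M} (m : e.toKaroubi ⟶ f.toKaroubi) :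
    (show M from m.f) * e.1 = m.f :=
  Karoubi.p_comp m

/-- The morphism `e ⟶ f` of the Karoubi envelope given by an element of `f M e`. -/
def karoubiHom (e f : Idem M) (m : M) (h1 : f.1 * m = m) (h2 : m * e.1 = m) :
    e.toKaroubi ⟶ f.toKaroubi where
  f := m
  comm := by
    change (f.1 * m) * e.1 = m
    rw [h1, h2]

theorem mul_coeMaxSubgroup {e : Idem M} (g : e.maxSubgroup) :
    e.1 * coeMaxSubgroup g = coeMaxSubgroup g := karoubi_mul_hom (e := e) (f := e) g.1

theorem coeMaxSubgroup_mul_self {e : Idem M} (g : e.maxSubgroup) :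
    coeMaxSubgroup g * e.1 = coeMaxSubgroup g := karoubi_hom_mul (e := e) (f := e) g.1

theorem leJ_coeMaxSubgroup {e : Idem M} (g : e.maxSubgroup) : e.LeJ (coeMaxSubgroup g) :=
  ⟨1, coeMaxSubgroup g⁻¹, by
    rw [one_mul, ← coeMaxSubgroup_mul, mul_inv_cancel, coeMaxSubgroup_one]⟩

theorem LeJ.exists_maxSubgroup (hM : IsDG M) {e : Idem M} {m : M} (h : e.LeJ m) :
    ∃ g : e.maxSubgroup, coeMaxSubgroup g = e.1 * m * e.1 := by
  obtain ⟨h1, c, h2, h3, h4, h5⟩ := h.exists_inverse hM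
  refine ⟨⟨End.of (karoubiHom e e (e.1 * m * e.1)
      (by simp only [mul_assoc, e.mul_self_assoc]) (by simp only [mul_assoc, e.mul_self])),
    End.of (karoubiHom e e c h2 h3), Karoubi.hom_ext _ _ ?_, Karoubi.hom_ext _ _ ?_⟩, rfl⟩
  · change e.1 * m * e.1 * c = e.1
    rw [mul_assoc, h2, mul_assoc, h4, e.mul_self]
  · change c * (e.1 * m * e.1) = e.1
    rw [← mul_assoc, ← mul_assoc, h3, h5, e.mul_self]

/-- The inverse `c` of `em` in `G_e` yields the retraction `cf`. With the dual statement for split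
epimorphisms, irreducibility becomes a condition on two-sided ideals. -/
theorem isSplitMono_iff_leJ (hM : IsDG M) {e f : Idem M} (m : e.toKaroubi ⟶ f.toKaroubi) :
    IsSplitMono m ↔ e.LeJ m.f := by
  constructor
  · rintro ⟨⟨r, hr⟩⟩
    refine ⟨r.f, 1, ?_⟩
    rw [mul_one]
    exact congrArg Karoubi.Hom.f hr
  · intro h
    obtain ⟨h1, c, h2, h3, h4, h5⟩ := h.exists_inverse hM
    refine ⟨⟨⟨karoubiHom f e (c * f.1) ?_ ?_, Karoubi.hom_ext _ _ ?_⟩⟩⟩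
    · rw [← mul_assoc, h2]
    · rw [mul_assoc, f.mul_self]
    · change c * f.1 * m.f = e.1
      rw [mul_assoc]
      exact (congrArg (c * ·) (karoubi_mul_hom m)).trans h5

theorem isSplitEpi_iff_leJ (hM : IsDG M) {e f : Idem M} (m : e.toKaroubi ⟶ f.toKaroubi) :
    IsSplitEpi m ↔ f.LeJ m.f := by
  constructor
  · rintro ⟨⟨r, hr⟩⟩
    refine ⟨1, r.f, ?_⟩
    rw [one_mul]
    exact congrArg Karoubi.Hom.f hr
  · intro h
    obtain ⟨h1, c, h2, h3, h4, h5⟩ := h.exists_inverse hM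
    refine ⟨⟨⟨karoubiHom f e (e.1 * c) ?_ ?_, Karoubi.hom_ext _ _ ?_⟩⟩⟩
    · rw [e.mul_self_assoc]
    · rw [mul_assoc, h3]
    · change (show M from m.f) * (e.1 * c) = f.1
      rw [← mul_assoc]
      exact (congrArg (· * c) (karoubi_hom_mul m)).trans h4

/-- The elements of `f M e` that are irreducible morphisms `e ⟶ f` of the Karoubi envelope. -/
def IsIrr (e f : Idem M) (m : M) : Prop :=
  f.1 * m = m ∧ m * e.1 = m ∧ ¬ e.LeJ m ∧ ¬ f.LeJ m ∧
    ∀ g h : M, m = g * h → e.LeJ h ∨ f.LeJ g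

theorem isIrreducibleMorphism_iff (hM : IsDG M) {e f : Idem M}
    (m : e.toKaroubi ⟶ f.toKaroubi) : IsIrreducibleMorphism m ↔ IsIrr e f m.f := by
  have hfm := karoubi_mul_hom m
  have hme := karoubi_hom_mul m
  unfold IsIrreducibleMorphism IsIrr
  rw [isSplitMono_iff_leJ hM, isSplitEpi_iff_leJ hM]
  constructor
  · rintro ⟨h1, h2, h3⟩
    refine ⟨hfm, hme, h1, h2, fun g h hgh => ?_⟩
    -- A factorization `m = gh` in `M` becomes one in the Karoubi envelope through the object `1`,
    -- as `(fg)(he)`.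
    let o : Idem M := ⟨1, one_mul 1⟩
    have := h3 o.toKaroubi
      (karoubiHom e o (h * e.1) (one_mul _) (by rw [mul_assoc, e.mul_self]))
      (karoubiHom o f (f.1 * g) (by rw [f.mul_self_assoc]) (mul_one _)) (Karoubi.hom_ext _ _ (by
        change m.f = f.1 * g * (h * e.1)
        calc m.f = f.1 * (show M from m.f) * e.1 := (by rw [hfm]; exact hme.symm)
          _ = f.1 * (g * h) * e.1 := by rw [← hgh]
          _ = _ := by simp only [mul_assoc]))
    rw [isSplitMono_iff_leJ hM, isSplitEpi_iff_leJ hM] at this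
    exact this.imp LeJ.left LeJ.right
  · rintro ⟨-, -, h1, h2, h3⟩
    refine ⟨h1, h2, ?_⟩
    rintro ⟨⟨⟩, z, hz⟩ h g hgh
    rw [show IsSplitMono h ↔ _ from isSplitMono_iff_leJ hM (f := ⟨z, hz⟩) h,
      show IsSplitEpi g ↔ _ from isSplitEpi_iff_leJ hM (e := ⟨z, hz⟩) g]
    exact h3 g.f h.f (congrArg Karoubi.Hom.f hgh)

/-- With `c`, `d` inverse to `a`, `b` relative to `f`, `e`, a factorization `amb = gh` gives `m =
(cg)(hd)`. -/
theorem IsIrr.mul (hM : IsDG M) {e f : Idem M} {m : M} (hm : IsIrr e f m) {a b : M}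
    (ha : f.LeJ a) (hb : e.LeJ b) : IsIrr e f (a * m * b) := by
  obtain ⟨h1, h2, h3, h4, h5⟩ := hm
  obtain ⟨ha1, c, -, -, -, hc⟩ := ha.exists_inverse hM
  obtain ⟨hb1, d, -, -, hd, -⟩ := hb.exists_inverse hM
  refine ⟨?_, ?_, fun h => h3 h.left.right, fun h => h4 h.left.right, fun g h hgh => ?_⟩
  · rw [← mul_assoc, ← mul_assoc, ha1, mul_assoc a, h1]
  · rw [mul_assoc, ← hb1, ← mul_assoc, mul_assoc a, h2]
  · have : m = c * g * (h * d) := by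
      calc m = c * a * m * (b * d) := by rw [hc, hd, h1, h2]
        _ = c * (a * m * b) * d := by simp only [mul_assoc]
        _ = _ := by rw [hgh]; simp only [mul_assoc]
    exact (h5 _ _ this).imp LeJ.left LeJ.right

theorem isIrr_mul_iff (hM : IsDG M) {e f : Idem M} {m : M} (hm : f.1 * m = m)
    (hm' : m * e.1 = m) {a b : M}
    (ha : f.LeJ a) (hb : e.LeJ b) : IsIrr e f (a * m * b) ↔ IsIrr e f m := by
  refine ⟨fun h => ?_, fun h => h.mul hM ha hb⟩
  obtain ⟨ha1, c, hc1, hc2, hc3, hc4⟩ := ha.exists_inverse hM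
  obtain ⟨hb1, d, hd1, hd2, hd3, hd4⟩ := hb.exists_inverse hM
  have := h.mul hM (a := c) (b := d) ⟨1, a, by rw [one_mul, hc4]⟩ ⟨b, 1, by rw [mul_one, hd3]⟩
  have h' : c * (a * m * b) * d = c * a * m * (b * d) := by simp only [mul_assoc]
  rwa [h', hc4, hd3, hm, hm'] at this

end Idem
end MonoidLemmas

/-! ### Derivations and their restriction to the irreducible morphisms -/

section Derivations

variable {k : Type u} [Field k] {M : Type v} [Monoid M]
variable {S T : Type*} [AddCommGroup S] [Module k S] [AddCommGroup T] [Module k T]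
variable (ρ : Representation k M S) (σ : Representation k M T)

/-- The derivations of the monoid `M` with values in the bimodule `Hom_k(S, T)`. -/
def monoidDerivations : Submodule k (M → S →ₗ[k] T) where
  carrier := {d | ∀ m n, d (m * n) = σ m ∘ₗ d n + d m ∘ₗ ρ n}
  add_mem' {d d'} h h' m n := by
    simp only [Pi.add_apply, h m n, h' m n, LinearMap.comp_add, LinearMap.add_comp]
    abel
  zero_mem' m n := by simp
  smul_mem' c d h m n := by
    simp only [Pi.smul_apply, h m n, LinearMap.comp_smul, LinearMap.smul_comp, smul_add]

/-- The inner derivation `m ↦ m X - X m`. -/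
def innerMonoidDerivation : (S →ₗ[k] T) →ₗ[k] monoidDerivations ρ σ where
  toFun X := ⟨fun m => σ m ∘ₗ X - X ∘ₗ ρ m, fun m n => by
    simp only [map_mul, Module.End.mul_eq_comp, LinearMap.comp_sub, LinearMap.sub_comp,
      LinearMap.comp_assoc]
    abel⟩
  map_add' X Y := by
    ext m : 2
    simp only [LinearMap.comp_add, LinearMap.add_comp, Submodule.coe_add, Pi.add_apply]
    abel
  map_smul' c X := by
    ext m : 2
    simp only [LinearMap.comp_smul, LinearMap.smul_comp, RingHom.id_apply, Submodule.coe_smul,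
      Pi.smul_apply, smul_sub]

/-- The idempotent `e` is the apex of a representation if it acts as the identity and the elements
`m` with `e ∉ M m M` act as zero. -/
def Idem.IsApex (e : Idem M) : Prop := ρ e.1 = LinearMap.id ∧ ∀ m, ¬ e.LeJ m → ρ m = 0

/-- The equivariant functions on the irreducible morphisms `e ⟶ f`, extended by zero to `M`. -/
def irrEquivariantMaps (e f : Idem M) : Submodule k (M → S →ₗ[k] T) where
  carrier := {F | (∀ m, ¬ Idem.IsIrr e f m → F m = 0) ∧
    ∀ a b, f.LeJ a → e.LeJ b → ∀ m, f.1 * m = m → m * e.1 = m →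
      F (a * m * b) = σ a ∘ₗ F m ∘ₗ ρ b}
  add_mem' {F F'} h h' := ⟨fun m hm => by simp [h.1 m hm, h'.1 m hm], fun a b ha hb m hm hm' => by
    simp only [Pi.add_apply, h.2 a b ha hb m hm hm', h'.2 a b ha hb m hm hm', LinearMap.comp_add,
      LinearMap.add_comp]⟩
  zero_mem' := ⟨fun m hm => rfl, fun a b ha hb m hm hm' => by simp⟩
  smul_mem' c F h := ⟨fun m hm => by simp [h.1 m hm], fun a b ha hb m hm hm' => by
    simp only [Pi.smul_apply, h.2 a b ha hb m hm hm', LinearMap.comp_smul, LinearMap.smul_comp]⟩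

variable {ρ σ}

section

variable {d : M → S →ₗ[k] T}

theorem monoidDerivations.map_mul_of_left (hd : d ∈ monoidDerivations ρ σ) {m n : M}
    (hm : σ m = 0) : d (m * n) = d m ∘ₗ ρ n := by
  rw [hd m n, hm, LinearMap.zero_comp, zero_add]

theorem monoidDerivations.map_mul_of_right (hd : d ∈ monoidDerivations ρ σ) {m n : M}
    (hn : ρ n = 0) : d (m * n) = σ m ∘ₗ d n := by
  rw [hd m n, hn, LinearMap.comp_zero, add_zero]

end

section Restriction

variable (hM : IsDG M) {e f : Idem M} (hρ : e.IsApex ρ) (hσ : f.IsApex σ)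
include hM hρ hσ

open Classical in
/-- The restriction of derivations to the irreducible morphisms. -/
noncomputable def restrictToIrr : monoidDerivations ρ σ →ₗ[k] irrEquivariantMaps ρ σ e f where
  toFun d := ⟨fun m => if Idem.IsIrr e f m then d.1 m else 0, fun m hm => if_neg hm,
    fun a b ha hb m hm hm' => by
      beta_reduce
      rw [Idem.isIrr_mul_iff hM hm hm' ha hb]
      split_ifs with h
      -- Since `m` is above neither `e` nor `f`, both representations annihilate it, and only the
      -- equivariant term of the Leibniz rule survives.
      · have h1 : ρ (m * b) = 0 := hρ.2 _ fun h' => h.2.2.1 h'.left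
        rw [mul_assoc, monoidDerivations.map_mul_of_right d.2 h1,
          monoidDerivations.map_mul_of_left d.2 (hσ.2 _ h.2.2.2.1)]
      · simp⟩
  map_add' d d' := by
    ext m : 2
    by_cases h : Idem.IsIrr e f m <;> simp [h]
  map_smul' c d := by
    ext m : 2
    by_cases h : Idem.IsIrr e f m <;> simp [h]

/-- Extend `F` to `G(m) = F(fme)`. It is left equivariant for `m ≥ f`, right equivariant for `m ≥
e`, and zero on products `mn` with `f ≰ m`, `e ≰ n` by irreducibility. Subtracting `σ(m) G(1)` gives
a derivation that vanishes at every `m ≥ f` and agrees with `F` on irreducible `m`, where `σ(m) =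
0`. -/
theorem restrictToIrr_surjective : Function.Surjective (restrictToIrr hM hρ hσ) := by
  classical
  rintro ⟨F, hF0, hF⟩
  set G : M → S →ₗ[k] T := fun m => F (f.1 * m * e.1) with hG
  have hl : ∀ a m, f.LeJ a → G (a * m) = σ a ∘ₗ G m := by
    intro a m ha
    have := hF a 1 ha (Idem.LeJ.one e) (f.1 * m * e.1)
      (by simp only [mul_assoc, f.mul_self_assoc]) (by simp only [mul_assoc, e.mul_self])
    rw [map_one, mul_one, Module.End.one_eq_id, LinearMap.comp_id] at this
    simp only [hG]
    rw [← this]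
    congr 1
    simp only [← mul_assoc]
    rw [ha.comm hM]
  have hr : ∀ m b, e.LeJ b → G (m * b) = G m ∘ₗ ρ b := by
    intro m b hb
    have := hF 1 b (Idem.LeJ.one f) hb (f.1 * m * e.1)
      (by simp only [mul_assoc, f.mul_self_assoc]) (by simp only [mul_assoc, e.mul_self])
    rw [map_one, one_mul, Module.End.one_eq_id, LinearMap.id_comp] at this
    simp only [hG]
    rw [← this]
    congr 1
    simp only [mul_assoc]
    rw [hb.comm hM]
  have h0 : ∀ m n, ¬ f.LeJ m → ¬ e.LeJ n → G (m * n) = 0 := by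
    intro m n hm hn
    refine hF0 _ fun h => ?_
    rcases h.2.2.2.2 (f.1 * m) (n * e.1) (by simp only [mul_assoc]) with h | h
    · exact hn h.left
    · exact hm h.right
  refine ⟨⟨fun m => G m - σ m ∘ₗ G 1, fun m n => ?_⟩, ?_⟩
  · beta_reduce
    by_cases hm : f.LeJ m <;> by_cases hn : e.LeJ n
    · have h1 : G m = σ m ∘ₗ G 1 := by rw [← hl m 1 hm, mul_one]
      rw [hl m n hm, ← h1, sub_self, LinearMap.zero_comp, add_zero, map_mul, LinearMap.comp_sub]
      rfl
    · rw [hl m n hm, hρ.2 n hn, map_mul, LinearMap.comp_sub, LinearMap.comp_zero, add_zero]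
      rfl
    · rw [hr m n hn, map_mul, hσ.2 m hm]
      simp
    · rw [h0 m n hm hn, map_mul, hσ.2 m hm, hρ.2 n hn]
      simp
  · ext m : 2
    change (if Idem.IsIrr e f m then G m - σ m ∘ₗ G 1 else 0) = F m
    split_ifs with h
    · rw [hσ.2 m h.2.2.2.1, LinearMap.zero_comp, sub_zero]
      simp only [hG]
      rw [h.1, h.2.1]
    · exact (hF0 m h).symm

theorem range_innerMonoidDerivation_le_ker :
    LinearMap.range (innerMonoidDerivation ρ σ) ≤ LinearMap.ker (restrictToIrr hM hρ hσ) := by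
  classical
  rintro _ ⟨X, rfl⟩
  ext m : 2
  change (if Idem.IsIrr e f m then σ m ∘ₗ X - X ∘ₗ ρ m else 0) = 0
  split_ifs with h
  · rw [hσ.2 m h.2.2.2.1, hρ.2 m h.2.2.1]
    simp
  · rfl

end Restriction

/-- Averaging: for `Y = ∑ d(h) τ(h⁻¹)` the Leibniz rule gives `|G| d(g) = Y τ(g) - τ'(g) Y`, so `X =
-Y / |G|` works. -/
theorem exists_inner_of_group {G : Type*} [Group G] [Finite G] (hG : (Nat.card G : k) ≠ 0)
    {τ : Representation k G S} {τ' : Representation k G T} {d : G → S →ₗ[k] T}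
    (hd : d ∈ monoidDerivations τ τ') :
    ∃ X : S →ₗ[k] T, ∀ g, d g = τ' g ∘ₗ X - X ∘ₗ τ g := by
  have := Fintype.ofFinite G
  set Y := ∑ h, d h ∘ₗ τ h⁻¹ with hY
  have key : ∀ g, (Nat.card G : k) • d g = Y ∘ₗ τ g - τ' g ∘ₗ Y := by
    intro g
    have h1 : τ' g ∘ₗ Y = ∑ h, (d (g * h) ∘ₗ τ h⁻¹ - d g) := by
      ext x
      simp only [hY, LinearMap.comp_apply, LinearMap.sum_apply, map_sum, LinearMap.sub_apply]
      refine Finset.sum_congr rfl fun h _ => ?_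
      have := LinearMap.congr_fun (hd g h) (τ h⁻¹ x)
      simp only [LinearMap.add_apply, LinearMap.comp_apply] at this
      rw [this, ← Module.End.mul_apply (τ h), ← map_mul, mul_inv_cancel, map_one,
        Module.End.one_apply, add_sub_cancel_right]
    have h2 : Y ∘ₗ τ g = ∑ h, d (g * h) ∘ₗ τ h⁻¹ := by
      have h3 : ∑ h, d (g * h) ∘ₗ τ h⁻¹ = ∑ h, d h ∘ₗ τ (h⁻¹ * g) :=
        Fintype.sum_equiv (Equiv.mulLeft g) _ _ fun h => by simp
      rw [h3]
      ext x
      simp [hY, LinearMap.sum_apply]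
    rw [h1, h2, Finset.sum_sub_distrib, sub_sub_cancel, Finset.sum_const, Finset.card_univ,
      ← Nat.card_eq_fintype_card, Nat.cast_smul_eq_nsmul]
  refine ⟨-(Nat.card G : k)⁻¹ • Y, fun g => ?_⟩
  rw [← inv_smul_smul₀ hG (d g), key]
  simp only [LinearMap.comp_smul, LinearMap.smul_comp, neg_smul, smul_sub, LinearMap.comp_neg,
    LinearMap.neg_comp]
  abel

section Kernel

variable [Finite M] (hM : IsDG M) {e f : Idem M} (hρ : e.IsApex ρ) (hσ : f.IsApex σ)

instance Idem.finite_maxSubgroup (e : Idem M) : Finite e.maxSubgroup :=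
  Finite.of_injective _ (Idem.coeMaxSubgroup_injective (e := e))

include hM hρ hσ

/-- Under the hypothesis, `d` vanishes on every element of `fMe` above neither `e` nor `f`: a
reducible one is a product that `d` kills. The identity `d(fme) = σ(m) d(e) + d(m) + d(f) ρ(m)` then
recovers `d(m)`. The witness is `-d(e)` if `e < f` or if `e`, `f` are incomparable, and `d(f)` if `f
< e`; for `e = f` it comes from averaging over `G_e`. -/
theorem exists_inner_of_restrictToIrr_eq_zero (hG : (Nat.card e.maxSubgroup : k) ≠ 0)
    {d : M → S →ₗ[k] T} (hd : d ∈ monoidDerivations ρ σ)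
    (h0 : ∀ m, Idem.IsIrr e f m → d m = 0) :
    ∃ X : S →ₗ[k] T, ∀ m, d m = σ m ∘ₗ X - X ∘ₗ ρ m := by
  have hprod : ∀ m n, ¬ f.LeJ m → ¬ e.LeJ n → d (m * n) = 0 := fun m n hm hn => by
    rw [monoidDerivations.map_mul_of_left hd (hσ.2 m hm), hρ.2 n hn, LinearMap.comp_zero]
  have h0' : ∀ m, ¬ e.LeJ m → ¬ f.LeJ m → f.1 * m = m → m * e.1 = m → d m = 0 := by
    intro m h1 h2 h3 h4
    by_cases h : Idem.IsIrr e f m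
    · exact h0 m h
    · have : ∃ g h, m = g * h ∧ ¬ e.LeJ h ∧ ¬ f.LeJ g := by
        by_contra! hcon
        exact h ⟨h3, h4, h1, h2, fun g h hgh => or_iff_not_imp_left.2 (hcon g h hgh)⟩
      obtain ⟨g, n, rfl, hg, hh⟩ := this
      exact hprod g n hh hg
  have h0'' : ∀ m, ¬ e.LeJ (f.1 * m * e.1) → ¬ f.LeJ (f.1 * m * e.1) → d (f.1 * m * e.1) = 0 :=
    fun m h1 h2 => h0' _ h1 h2 (by simp only [mul_assoc, f.mul_self_assoc])
      (by simp only [mul_assoc, e.mul_self])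
  have hsand : ∀ m, d (f.1 * m * e.1) = σ m ∘ₗ d e.1 + d m + d f.1 ∘ₗ ρ m := by
    intro m
    have h1 : d (f.1 * m) = d m + d f.1 ∘ₗ ρ m := by
      rw [hd f.1 m, hσ.1, LinearMap.id_comp]
    have h2 : σ (f.1 * m) = σ m := by
      rw [map_mul, hσ.1]
      rfl
    rw [hd, hρ.1, LinearMap.comp_id, h1, h2, add_assoc]
  by_cases hef : e = f
  · subst hef
    have hde : d e.1 = 0 := by
      have := hd e.1 e.1
      rw [e.mul_self, hρ.1, hσ.1, LinearMap.id_comp, LinearMap.comp_id] at this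
      exact left_eq_add.1 this
    have hdm : ∀ m, d m = d (e.1 * m * e.1) := fun m => by
      rw [hsand, hde]
      simp
    let ι : e.maxSubgroup → M := Idem.coeMaxSubgroup
    let τ : Representation k e.maxSubgroup S :=
      { toFun := fun g => ρ (ι g), map_one' := hρ.1,
        map_mul' := fun g h => by rw [← map_mul, ← Idem.coeMaxSubgroup_mul] }
    let τ' : Representation k e.maxSubgroup T :=
      { toFun := fun g => σ (ι g), map_one' := hσ.1,
        map_mul' := fun g h => by rw [← map_mul, ← Idem.coeMaxSubgroup_mul] }
    obtain ⟨X, hX⟩ := exists_inner_of_group hG (τ := τ) (τ' := τ') (d := fun g => d (ι g))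
      fun g h => hd (ι g) (ι h)
    refine ⟨X, fun m => ?_⟩
    rw [hdm]
    by_cases hm : e.LeJ m
    · obtain ⟨g, hg⟩ := hm.exists_maxSubgroup hM
      have hρm : ρ (ι g) = ρ m := by
        rw [show ι g = _ from hg, map_mul, map_mul, hρ.1]
        rfl
      have hσm : σ (ι g) = σ m := by
        rw [show ι g = _ from hg, map_mul, map_mul, hσ.1]
        rfl
      rw [← hg, ← hρm, ← hσm]
      exact hX g
    · rw [h0'' m (fun h => hm h.left.right) (fun h => hm h.left.right), hρ.2 m hm, hσ.2 m hm]
      simp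
  · by_cases h1 : e.LeJ f.1
    · have hf : ¬ f.LeJ e.1 := fun h => hef (h1.antisymm hM h)
      obtain ⟨hfe, hef'⟩ := h1.mul_eq hM
      have hρf : ρ f.1 = LinearMap.id := by
        have := congrArg ρ hfe
        rw [map_mul, hρ.1] at this
        exact this
      have hdf : d f.1 = 0 := by
        have := hd f.1 f.1
        rw [f.mul_self, hρf, hσ.1, LinearMap.id_comp, LinearMap.comp_id] at this
        exact left_eq_add.1 this
      refine ⟨-d e.1, fun m => ?_⟩
      -- For `e ≤ m` one has `fme = em`, and `σ(e) = 0` because `f ≰ e`; otherwise both sides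
      -- vanish.
      have key : d (f.1 * m * e.1) = d e.1 ∘ₗ ρ m := by
        by_cases hm : e.LeJ m
        · have : f.1 * m * e.1 = e.1 * m := by
            rw [mul_assoc, ← hm.comm hM, ← mul_assoc, hfe]
          rw [this, monoidDerivations.map_mul_of_left hd (hσ.2 _ hf)]
        · rw [h0'' m (fun h => hm h.left.right) (fun h => hf h.right), hρ.2 m hm,
            LinearMap.comp_zero]
      have := hsand m
      rw [key, hdf, LinearMap.zero_comp, add_zero] at this
      rw [LinearMap.comp_neg, LinearMap.neg_comp, sub_neg_eq_add]
      refine Eq.trans ?_ (congrArg (-(σ m ∘ₗ d e.1) + ·) this.symm)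
      abel
    · by_cases h2 : f.LeJ e.1
      · obtain ⟨hfe, hef'⟩ := h2.mul_eq hM
        have hσe : σ e.1 = LinearMap.id := by
          have := congrArg σ hfe
          rw [map_mul, hσ.1] at this
          exact this
        have hde : d e.1 = 0 := by
          have := hd e.1 e.1
          rw [e.mul_self, hρ.1, hσe, LinearMap.id_comp, LinearMap.comp_id] at this
          exact left_eq_add.1 this
        refine ⟨d f.1, fun m => ?_⟩
        have key : d (f.1 * m * e.1) = σ m ∘ₗ d f.1 := by
          by_cases hm : f.LeJ m
          · have : f.1 * m * e.1 = m * f.1 := by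
              rw [hm.comm hM, mul_assoc, hef']
            rw [this, monoidDerivations.map_mul_of_right hd (hρ.2 _ h1)]
          · rw [h0'' m (fun h => h1 h.left.left) (fun h => hm h.left.right), hσ.2 m hm,
              LinearMap.zero_comp]
        have := hsand m
        rw [key, hde, LinearMap.comp_zero, zero_add] at this
        rw [this]
        abel
      · have hz : ∀ m, d (f.1 * m * e.1) = 0 := fun m =>
          h0'' m (fun h => h1 h.left.left) (fun h => h2 h.right)
        -- The sandwich identity at `m = 1`, where `d(1) = 0`.
        have h3 : d f.1 = -d e.1 := by
          have := hsand 1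
          have h1 : d 1 = 0 := by
            have := hd 1 1
            rw [mul_one, map_one, map_one, Module.End.one_eq_id, Module.End.one_eq_id,
              LinearMap.id_comp, LinearMap.comp_id] at this
            exact left_eq_add.1 this
          rw [hz, h1, map_one, map_one, Module.End.one_eq_id, Module.End.one_eq_id,
            LinearMap.id_comp, LinearMap.comp_id, add_zero] at this
          exact eq_neg_of_add_eq_zero_right this.symm
        refine ⟨-d e.1, fun m => ?_⟩
        have := hsand m
        rw [hz, h3, LinearMap.neg_comp] at this
        rw [LinearMap.comp_neg, LinearMap.neg_comp, sub_neg_eq_add, eq_comm, ← sub_eq_zero]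
        rw [← neg_eq_zero, this]
        abel

theorem ker_restrictToIrr (hG : (Nat.card e.maxSubgroup : k) ≠ 0) :
    LinearMap.ker (restrictToIrr hM hρ hσ) = LinearMap.range (innerMonoidDerivation ρ σ) := by
  classical
  refine le_antisymm (fun d hd => ?_) (range_innerMonoidDerivation_le_ker hM hρ hσ)
  obtain ⟨X, hX⟩ := exists_inner_of_restrictToIrr_eq_zero hM hρ hσ hG d.2 fun m hm => by
    have : (if Idem.IsIrr e f m then d.1 m else 0) = 0 :=
      congrFun (congrArg Subtype.val (LinearMap.mem_ker.1 hd)) m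
    rwa [if_pos hm] at this
  exact ⟨X, Subtype.ext (funext fun m => (hX m).symm)⟩

end Kernel

end Derivations

/-! ### `Ext¹` from a presentation with projective middle term -/

section ExtOne

open CategoryTheory.Abelian

variable {k : Type*} [Field k] {C : Type*} [Category C] [Abelian C] [Linear k C] [HasExt.{w} C]

/-- The connecting homomorphism to `Ext¹` of a short exact sequence. -/
noncomputable def extOneConnecting {X : ShortComplex C} (hX : X.ShortExact) (Y : C) :
    (X.X₁ ⟶ Y) →ₗ[k] Ext.{w} X.X₃ Y 1 :=
  (Ext.bilinearCompOfLinear k X.X₃ X.X₁ Y 1 0 1 (add_zero 1) hX.extClass) ∘ₗ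
    (Ext.linearEquiv₀ (R := k)).symm.toLinearMap

theorem extOneConnecting_apply {X : ShortComplex C} (hX : X.ShortExact) (Y : C) (f : X.X₁ ⟶ Y) :
    extOneConnecting (k := k) hX Y f = hX.extClass.comp (Ext.mk₀ f) (add_zero 1) := rfl

theorem extOneConnecting_surjective {X : ShortComplex C} (hX : X.ShortExact) (Y : C)
    [Projective X.X₂] : Function.Surjective (extOneConnecting (k := k) hX Y) := by
  intro x
  obtain ⟨y, hy⟩ := Ext.contravariant_sequence_exact₃ hX Y x
    (Ext.eq_zero_of_projective _) (n₀ := 0) (add_zero 1)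
  obtain ⟨f, rfl⟩ := (Ext.mk₀_bijective _ _).2 y
  exact ⟨f, hy⟩

/-- Exactness of the long exact sequence at `Hom(X₁, Y)`: the kernel consists of the maps that
extend to `X₂`. -/
theorem extOneConnecting_eq_zero_iff {X : ShortComplex C} (hX : X.ShortExact) (Y : C)
    (f : X.X₁ ⟶ Y) : extOneConnecting (k := k) hX Y f = 0 ↔ ∃ g : X.X₂ ⟶ Y, X.f ≫ g = f := by
  rw [extOneConnecting_apply]
  constructor
  · intro h
    obtain ⟨y, hy⟩ := Ext.contravariant_sequence_exact₁ hX Y (Ext.mk₀ f) (add_zero 1) h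
    obtain ⟨g, rfl⟩ := (Ext.mk₀_bijective _ _).2 y
    rw [Ext.mk₀_comp_mk₀] at hy
    exact ⟨g, (Ext.mk₀_bijective _ _).1 hy⟩
  · rintro ⟨g, rfl⟩
    rw [← Ext.mk₀_comp_mk₀, hX.extClass_comp_assoc]

end ExtOne

/-! ### Homomorphisms from the kernel of `k[M] ⊗ S → S` as derivations -/

section Bar

variable {k : Type u} [Field k] {M : Type v} [Monoid M] (S T : ModuleCat.{max u v} k[M])

/-- The action map of a module, from the induced module. -/
noncomputable def inducedAction : k[M] ⊗[k] S →ₗ[k[M]] S :=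
  TensorProduct.AlgebraTensorModule.lift
    { toFun := fun a =>
        { toFun := fun s => a • s
          map_add' := smul_add a
          map_smul' := fun c s => smul_comm a c s }
      map_add' := fun a b => by ext; simp [add_smul]
      map_smul' := fun a b => by ext; simp [mul_smul] }

theorem inducedAction_tmul (a : k[M]) (s : S) : inducedAction S (a ⊗ₜ s) = a • s := rfl

theorem inducedAction_surjective : Function.Surjective (inducedAction (k := k) S) := fun s =>
  ⟨1 ⊗ₜ s, by rw [inducedAction_tmul, one_smul]⟩

/-- The presentation `0 → K → k[M] ⊗ S → S → 0`. -/
noncomputable def inducedPresentation : ShortComplex (ModuleCat.{max u v} k[M]) where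
  X₁ := ModuleCat.of k[M] (LinearMap.ker (inducedAction (k := k) S))
  X₂ := ModuleCat.of k[M] (k[M] ⊗[k] S)
  X₃ := S
  f := ModuleCat.ofHom (Submodule.subtype _)
  g := ModuleCat.ofHom (inducedAction S)
  zero := by
    ext x
    exact x.2

theorem inducedPresentation_shortExact : (inducedPresentation (k := k) S).ShortExact where
  exact := by
    rw [ShortComplex.moduleCat_exact_iff]
    exact fun x hx => ⟨⟨x, hx⟩, rfl⟩
  mono_f := (ModuleCat.mono_iff_injective _).2 Subtype.val_injective
  epi_g := (ModuleCat.epi_iff_surjective _).2 (inducedAction_surjective S)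

instance inducedPresentation_projective : Projective (inducedPresentation (k := k) S).X₂ :=
  (IsProjective.iff_projective (R := k[M]) (P := k[M] ⊗[k] S)).1 inferInstance

/-- The element `x - 1 ⊗ x • 1` of the kernel of the action map. -/
noncomputable def inducedRelation : k[M] ⊗[k] S →ₗ[k] LinearMap.ker (inducedAction (k := k) S) where
  toFun x := ⟨x - 1 ⊗ₜ inducedAction S x, by
    rw [LinearMap.mem_ker, map_sub, inducedAction_tmul, one_smul, sub_self]⟩
  map_add' x y := Subtype.ext <| by
    simp only [map_add, TensorProduct.tmul_add, Submodule.coe_add]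
    abel
  map_smul' c x := Subtype.ext <| by
    have : inducedAction S (c • x) = c • inducedAction S x :=
      (inducedAction (k := k) S).map_smul_of_tower c x
    change c • x - 1 ⊗ₜ inducedAction S (c • x) = c • (x - 1 ⊗ₜ inducedAction S x)
    rw [this, TensorProduct.tmul_smul]
    exact (smul_sub c x _).symm

theorem inducedRelation_coe (x : LinearMap.ker (inducedAction (k := k) S)) :
    inducedRelation S x.1 = x := Subtype.ext <| by
  change x.1 - 1 ⊗ₜ inducedAction S x.1 = x.1
  rw [LinearMap.mem_ker.1 x.2, TensorProduct.tmul_zero, sub_zero]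

/-- The universal Leibniz rule: applying a homomorphism to it turns `m ↦ φ(m ⊗ s - 1 ⊗ ms)` into a
derivation. -/
theorem inducedRelation_single_mul (m n : M) (s : S) :
    inducedRelation S (MonoidAlgebra.single (m * n) (1 : k) ⊗ₜ s) =
      MonoidAlgebra.single m (1 : k) • inducedRelation S (MonoidAlgebra.single n (1 : k) ⊗ₜ s) +
        inducedRelation S (MonoidAlgebra.single m (1 : k) ⊗ₜ
          (MonoidAlgebra.single n (1 : k) • s)) := Subtype.ext <| by
  change _ - _ = MonoidAlgebra.single m (1 : k) • (_ - _) + (_ - _)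
  simp only [smul_sub, TensorProduct.smul_tmul', inducedAction_tmul, smul_smul, smul_eq_mul,
    MonoidAlgebra.single_mul_single, mul_one]
  abel

variable {S T}

/-- `inducedRelation` is a `k`-linear projection onto the kernel, so its values on `m ⊗ s` span the
kernel. -/
theorem ext_inducedRelation {φ ψ : LinearMap.ker (inducedAction (k := k) S) →ₗ[k[M]] T}
    (h : ∀ m s, φ (inducedRelation S (MonoidAlgebra.single m (1 : k) ⊗ₜ s)) =
      ψ (inducedRelation S (MonoidAlgebra.single m (1 : k) ⊗ₜ s))) : φ = ψ := by
  have key : ∀ x, φ (inducedRelation S x) = ψ (inducedRelation S x) := by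
    intro x
    induction x using TensorProduct.induction_on with
    | zero => simp
    | add x y hx hy => simp only [map_add, hx, hy]
    | tmul a s =>
      induction a using MonoidAlgebra.induction_linear with
      | zero => simp
      | add x y hx hy => simp only [TensorProduct.add_tmul, map_add, hx, hy]
      | single m c =>
        have : (MonoidAlgebra.single m c : k[M]) ⊗ₜ[k] s =
            MonoidAlgebra.single m (1 : k) ⊗ₜ (c • s) := by
          rw [← TensorProduct.smul_tmul, MonoidAlgebra.smul_single, smul_eq_mul, mul_one]
        rw [this, h]
  refine LinearMap.ext fun x => ?_
  have := key x.1
  rwa [inducedRelation_coe] at this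

variable (S T)

/-- The derivation attached to a homomorphism from the kernel of the action map. -/
noncomputable def derivationOfKer : (LinearMap.ker (inducedAction (k := k) S) →ₗ[k[M]] T) →ₗ[k]
    monoidDerivations (Representation.ofModule' (k := k) (G := M) S)
      (Representation.ofModule' (k := k) (G := M) T) where
  toFun φ := ⟨fun m =>
    { toFun := fun s => φ (inducedRelation S (MonoidAlgebra.single m (1 : k) ⊗ₜ s))
      map_add' := fun s t => by rw [TensorProduct.tmul_add, map_add, map_add]
      map_smul' := fun c s => by
        rw [TensorProduct.tmul_smul, map_smul]
        exact φ.map_smul_of_tower c _ }, fun m n => by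
    ext s
    have := congrArg φ (inducedRelation_single_mul S m n s)
    rwa [map_add, map_smul] at this⟩
  map_add' φ ψ := rfl
  map_smul' c φ := rfl

theorem derivationOfKer_injective : Function.Injective (derivationOfKer (k := k) S T) := by
  intro φ ψ h
  refine ext_inducedRelation fun m s => ?_
  exact LinearMap.congr_fun (congrFun (congrArg Subtype.val h) m) s

/-- The linear extension `Φ` of `d` to `k[M] ⊗ S` satisfies `Φ(ax) = aΦ(x) + D(a)(x̄)`, with `x̄`
the image of `x` in `S`; on the kernel the error term disappears. -/
theorem derivationOfKer_surjective : Function.Surjective (derivationOfKer (k := k) S T) := by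
  rintro ⟨d, hd⟩
  let D : k[M] →ₗ[k] S →ₗ[k] T :=
    Finsupp.linearCombination k d ∘ₗ (MonoidAlgebra.coeffLinearEquiv k).toLinearMap
  have hD : ∀ m c, D (MonoidAlgebra.single m c) = c • d m := fun m c => by
    simp [D, MonoidAlgebra.coeffLinearEquiv]
  let Φ : k[M] ⊗[k] S →ₗ[k] T := TensorProduct.lift D
  have hΦ : ∀ a s, Φ (a ⊗ₜ s) = D a s := fun a s => rfl
  have hd1 : d 1 = 0 := by
    have := hd 1 1
    rw [mul_one, map_one, map_one, Module.End.one_eq_id, Module.End.one_eq_id,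
      LinearMap.id_comp, LinearMap.comp_id] at this
    exact left_eq_add.1 this
  have key : ∀ (a : k[M]) (x : k[M] ⊗[k] S), Φ (a • x) = a • Φ x + D a (inducedAction S x) := by
    intro a x
    induction x using TensorProduct.induction_on with
    | zero => simp
    | add x y hx hy =>
      simp only [smul_add, map_add, hx, hy]
      abel
    | tmul b s =>
      rw [TensorProduct.smul_tmul', hΦ, hΦ, inducedAction_tmul, smul_eq_mul]
      induction b using MonoidAlgebra.induction_linear with
      | zero => simp
      | add x y hx hy =>
        simp only [mul_add, map_add, LinearMap.add_apply, hx, hy, smul_add, add_smul]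
        abel
      | single n c =>
        induction a using MonoidAlgebra.induction_linear with
        | zero => simp
        | add x y hx hy =>
          simp only [add_mul, map_add, LinearMap.add_apply, hx, hy, add_smul]
          abel
        | single m b =>
          have h1 : ∀ (p : M) (a : k) (N : ModuleCat.{max u v} k[M]) (x : N),
              (MonoidAlgebra.single p a : k[M]) • x = a • MonoidAlgebra.single p (1 : k) • x := by
            intro p a N x
            rw [← smul_assoc, MonoidAlgebra.smul_single, smul_eq_mul, mul_one]
          have h2 := LinearMap.congr_fun (hd m n) s
          simp only [LinearMap.add_apply, LinearMap.comp_apply] at h2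
          rw [MonoidAlgebra.single_mul_single, hD, hD, hD, h1 m b, h1 n c]
          simp only [LinearMap.smul_apply, map_smul, h2]
          rw [smul_comm (MonoidAlgebra.single m (1 : k)) c, mul_smul, smul_add, smul_add,
            smul_comm c b]
          rfl
  refine ⟨
    { toFun := fun x => Φ x.1
      map_add' := fun x y => by rw [Submodule.coe_add, map_add]
      map_smul' := fun a x => by
        rw [Submodule.coe_smul, key, LinearMap.mem_ker.1 x.2, map_zero, add_zero]
        rfl }, ?_⟩
  ext m s
  change Φ ((MonoidAlgebra.single m (1 : k)) ⊗ₜ[k] s -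
    (1 : k[M]) ⊗ₜ[k] (MonoidAlgebra.single m (1 : k) • s)) = d m s
  rw [map_sub, hΦ, hΦ, MonoidAlgebra.one_def, hD, hD, hd1]
  simp

/-- By the universal property of the induced module, `X` corresponds to the map `g` with `g(1 ⊗ s) =
X(s)`, and the restriction of `g` to the kernel gives the inner derivation of `X`. -/
theorem derivationOfKer_mem_range_inner_iff
    (φ : LinearMap.ker (inducedAction (k := k) S) →ₗ[k[M]] T) :
    derivationOfKer S T φ ∈ LinearMap.range (innerMonoidDerivation
      (Representation.ofModule' (k := k) (G := M) S)
      (Representation.ofModule' (k := k) (G := M) T)) ↔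
    ∃ g : k[M] ⊗[k] S →ₗ[k[M]] T, g ∘ₗ Submodule.subtype _ = φ := by
  constructor
  · rintro ⟨X, hX⟩
    let ψ : k[M] ⊗[k] S →ₗ[k[M]] T := TensorProduct.AlgebraTensorModule.lift
      { toFun := fun a =>
          { toFun := fun s => a • X s
            map_add' := fun s t => by rw [map_add, smul_add]
            map_smul' := fun c s => by rw [map_smul, smul_comm]; rfl }
        map_add' := fun a b => by ext; simp [add_smul]
        map_smul' := fun a b => by ext; simp [mul_smul] }
    refine ⟨ψ, derivationOfKer_injective S T ?_⟩
    rw [← hX]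
    ext m s
    change ψ ((MonoidAlgebra.single m (1 : k)) ⊗ₜ[k] s -
      (1 : k[M]) ⊗ₜ[k] (MonoidAlgebra.single m (1 : k) • s)) =
      MonoidAlgebra.single m (1 : k) • X s - X (MonoidAlgebra.single m (1 : k) • s)
    rw [map_sub]
    change MonoidAlgebra.single m (1 : k) • X s -
      (1 : k[M]) • X (MonoidAlgebra.single m (1 : k) • s) = _
    rw [one_smul]
  · rintro ⟨g, rfl⟩
    let X : S →ₗ[k] T :=
      { toFun := fun s => g ((1 : k[M]) ⊗ₜ[k] s)
        map_add' := fun s t => by rw [TensorProduct.tmul_add, map_add]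
        map_smul' := fun c s => by
          rw [TensorProduct.tmul_smul]
          exact g.map_smul_of_tower c _ }
    refine ⟨X, ?_⟩
    ext m s
    change MonoidAlgebra.single m (1 : k) • g ((1 : k[M]) ⊗ₜ[k] s) -
      g ((1 : k[M]) ⊗ₜ[k] (MonoidAlgebra.single m (1 : k) • s)) =
      g (MonoidAlgebra.single m (1 : k) ⊗ₜ[k] s -
        (1 : k[M]) ⊗ₜ[k] (MonoidAlgebra.single m (1 : k) • s))
    rw [← map_smul, ← map_sub, TensorProduct.smul_tmul', smul_eq_mul, mul_one]

end Bar

/-! ### `Ext¹` as equivariant functions -/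

section Main

variable {k : Type u} [Field k] {M : Type v} [Monoid M] [Finite M]

open CategoryTheory.Abelian in
/-- `Ext¹` of modules with apexes `e` and `f` in terms of the irreducible morphisms `e ⟶ f`. -/
theorem nonempty_extOne_equiv (hM : IsDG M) {e f : Idem M} (S T : ModuleCat.{max u v} k[M])
    (hS : e.IsApex (Representation.ofModule' (k := k) (G := M) S))
    (hT : f.IsApex (Representation.ofModule' (k := k) (G := M) T))
    (hG : (Nat.card e.maxSubgroup : k) ≠ 0) :
    Nonempty (Ext S T 1 ≃ₗ[k] irrEquivariantMaps (Representation.ofModule' (k := k) (G := M) S)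
      (Representation.ofModule' (k := k) (G := M) T) e f) := by
  let α := extOneConnecting (k := k) (inducedPresentation_shortExact (k := k) S) T
  let γ : ((inducedPresentation (k := k) S).X₁ ⟶ T) →ₗ[k]
      (LinearMap.ker (inducedAction (k := k) S) →ₗ[k[M]] T) :=
    { toFun := fun φ => φ.hom, map_add' := fun _ _ => rfl, map_smul' := fun _ _ => rfl }
  have hγ : Function.Surjective γ := fun φ => ⟨ModuleCat.ofHom φ, rfl⟩
  let β := restrictToIrr hM hS hT ∘ₗ derivationOfKer S T ∘ₗ γ
  have hα : Function.Surjective α := extOneConnecting_surjective _ _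
  have hβ : Function.Surjective β :=
    (restrictToIrr_surjective hM hS hT).comp ((derivationOfKer_surjective S T).comp hγ)
  -- Both surjections kill exactly the homomorphisms that extend to `k[M] ⊗ S`, so their targets are
  -- isomorphic.
  have hker : LinearMap.ker α = LinearMap.ker β := by
    ext φ
    have h1 : φ ∈ LinearMap.ker β ↔ derivationOfKer S T (γ φ) ∈
      LinearMap.ker (restrictToIrr hM hS hT) := Iff.rfl
    rw [h1, ker_restrictToIrr hM hS hT hG, derivationOfKer_mem_range_inner_iff, LinearMap.mem_ker]
    refine (extOneConnecting_eq_zero_iff _ _ _).trans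
      ⟨fun ⟨g, hg⟩ => ⟨g.hom, congrArg ModuleCat.Hom.hom hg⟩,
        fun ⟨g, hg⟩ => ⟨ModuleCat.ofHom g, ModuleCat.hom_ext hg⟩⟩
  exact ⟨(α.quotKerEquivOfSurjective hα).symm ≪≫ₗ Submodule.quotEquivOfEq _ _ hker ≪≫ₗ
    β.quotKerEquivOfSurjective hβ⟩

end Main

theorem exists_dual_apply_eq_one {k V : Type*} [Field k] [AddCommGroup V] [Module k V] {x : V}
    (hx : x ≠ 0) : ∃ f : Module.Dual k V, f x = 1 := by
  obtain ⟨f, hf⟩ := not_forall.1 (mt (Module.forall_dual_apply_eq_zero_iff k x).1 hx)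
  exact ⟨(f x)⁻¹ • f, inv_mul_cancel₀ hf⟩

/-! ### Simple modules over split algebras -/

section Split

variable {k : Type*} [Field k] {A : Type*} [Ring A] [Algebra k A]
variable {V : Type*} [AddCommGroup V] [Module k V] [Module A V] [IsScalarTower k A V]

theorem jacobson_smul_eq_zero [IsSimpleModule A V] {a : A} (ha : a ∈ Ring.jacobson A) (v : V) :
    a • v = 0 :=
  Module.mem_annihilator.1 (IsSemisimpleModule.jacobson_le_annihilator A V ha) v

/-- Over a split algebra, the endomorphisms of simple modules are scalars. -/
theorem SplitsOver.exists_smul_eq (h : SplitsOver k A) [IsSimpleModule A V] (D : V →ₗ[A] V) :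
    ∃ c : k, ∀ x, D x = c • x := by
  obtain ⟨n, d, ⟨φ⟩⟩ := h
  let q : A → ∀ i, Matrix (Fin (d i)) (Fin (d i)) k := fun a => φ (Ideal.Quotient.mk _ a)
  have hq : ∀ a b : A, q a = q b → ∀ v : V, a • v = b • v := by
    intro a b hab v
    have := Ideal.Quotient.eq.1 (φ.injective hab)
    rw [← sub_eq_zero, ← sub_smul, jacobson_smul_eq_zero this]
  have hqs : Function.Surjective q := φ.surjective.comp Ideal.Quotient.mk_surjective
  have hqmul : ∀ a b, q (a * b) = q a * q b := fun a b => by simp [q]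
  -- Lifts of the diagonal matrix units. Modulo the radical they add up to `1`, so one of them does
  -- not kill `v`.
  choose ε hε using fun p : Σ i, Fin (d i) => hqs (Pi.single p.1 (Matrix.single p.2 p.2 (1 : k)))
  have hsum : q (∑ p, ε p) = q 1 := by
    have h1 : q (∑ p, ε p) = ∑ p, q (ε p) := by simp [q]
    have h2 : q 1 = 1 := by simp [q]
    rw [h1, h2]
    simp only [hε]
    rw [Fintype.sum_sigma]
    ext i : 1
    rw [Finset.sum_apply, Finset.sum_eq_single i]
    · rw [Finset.sum_apply]
      simp only [Pi.single_eq_same, Pi.one_apply]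
      ext a b
      simp [Matrix.sum_apply, Matrix.single_apply, Matrix.one_apply, ite_and]
    · intro j _ hj
      rw [Finset.sum_apply]
      exact Finset.sum_eq_zero fun x _ => Pi.single_eq_of_ne hj.symm _
    · simp
  have : Nontrivial V := IsSimpleModule.nontrivial A V
  obtain ⟨v, hv⟩ := exists_ne (0 : V)
  obtain ⟨p, hp⟩ : ∃ p, ε p • v ≠ 0 := by
    by_contra! hcon
    apply hv
    have := hq _ _ hsum v
    rw [one_smul, Finset.sum_smul] at this
    rw [← this]
    exact Finset.sum_eq_zero fun p _ => hcon p
  obtain ⟨a, ha⟩ := (IsSimpleModule.toSpanSingleton_surjective A hp) (D (ε p • v))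
  rw [LinearMap.toSpanSingleton_apply] at ha
  have hidem : ε p • ε p • v = ε p • v := by
    rw [smul_smul]
    refine hq _ _ ?_ v
    rw [hqmul, hε, ← Pi.single_mul, Matrix.single_mul_single_same, mul_one]
  -- A diagonal matrix unit cuts out a one-dimensional corner, so `D` multiplies `ε p • v` by a
  -- scalar `c`; by Schur's lemma `D - c` is then zero.
  obtain ⟨c, hc⟩ : ∃ c : k, q (ε p * a * ε p) = q (algebraMap k A c * ε p) := by
    refine ⟨(q a p.1) p.2 p.2, ?_⟩
    have h3 : ∀ c, q (algebraMap k A c) = algebraMap k _ c := fun c => by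
      simp only [q, ← φ.commutes]
      rfl
    rw [hqmul, hqmul, hqmul, hε, h3, ← Algebra.smul_def]
    ext i : 1
    by_cases hi : i = p.1
    · subst hi
      simp only [Pi.mul_apply, Pi.single_eq_same, Pi.smul_apply]
      rw [Matrix.single_mul_mul_single]
      simp [Matrix.smul_single]
    · simp [Pi.single_eq_of_ne hi]
  have hDc : D (ε p • v) = c • ε p • v := by
    rw [← hidem, map_smul, ← ha, smul_smul, smul_smul, hq _ _ hc, mul_smul, algebraMap_smul, hidem]
  have hz : D - c • LinearMap.id = 0 := by
    refine (LinearMap.injective_or_eq_zero (D - c • LinearMap.id)).resolve_left fun hinj => hp ?_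
    refine hinj ?_
    rw [map_zero, LinearMap.sub_apply, hDc, LinearMap.smul_apply, LinearMap.id_apply, sub_self]
  refine ⟨c, fun x => ?_⟩
  simpa [sub_eq_zero] using LinearMap.congr_fun hz x

/-- Burnside's theorem for simple modules over split algebras. -/
theorem SplitsOver.lsmul_surjective (h : SplitsOver k A) [IsSimpleModule A V] [Module.Finite k V] :
    Function.Surjective (Algebra.lsmul k k V : A →ₐ[k] Module.End k V) := by
  classical
  intro T
  -- The `A`-endomorphisms being scalars, any `k`-linear `T` commutes with them, and the density
  -- theorem applies to `T` on a basis.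
  let f : Module.End (Module.End A V) V :=
    { toFun := T
      map_add' := T.map_add
      map_smul' := fun D x => by
        obtain ⟨c, hc⟩ := h.exists_smul_eq D
        simp only [Module.End.smul_def, hc, map_smul, RingHom.id_apply] }
  let b := Module.finBasis k V
  obtain ⟨a, ha⟩ := jacobson_density f (Finset.univ.image b)
  refine ⟨a, b.ext fun i => ?_⟩
  exact (ha (b i) (by simp)).symm

section FullEnd

variable (hA : Function.Surjective (Algebra.lsmul k k V : A →ₐ[k] Module.End k V)) [Nontrivial V]
include hA

/-- Rank-one endomorphisms carry any nonzero vector to any other vector. -/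
theorem isSimpleModule_of_lsmul_surjective : IsSimpleModule A V := by
  rw [isSimpleModule_iff_toSpanSingleton_surjective]
  refine ⟨inferInstance, fun x hx y => ?_⟩
  obtain ⟨f, hf⟩ := exists_dual_apply_eq_one (k := k) hx
  obtain ⟨a, ha⟩ := hA (f.smulRight y)
  refine ⟨a, ?_⟩
  have := LinearMap.congr_fun ha x
  simpa [hf] using this

theorem exists_smul_eq_of_lsmul_surjective (D : V →ₗ[A] V) : ∃ c : k, ∀ x, D x = c • x := by
  obtain ⟨x, hx⟩ := exists_ne (0 : V)
  obtain ⟨f, hf⟩ := exists_dual_apply_eq_one (k := k) hx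
  refine ⟨f (D x), fun y => ?_⟩
  obtain ⟨a, ha⟩ := hA (f.smulRight y)
  have h1 := LinearMap.congr_fun ha x
  have h2 := LinearMap.congr_fun ha (D x)
  simp only [Algebra.lsmul_coe, LinearMap.smulRight_apply] at h1 h2
  rw [hf, one_smul] at h1
  rw [← h1, map_smul, h2, h1]

end FullEnd
end Split

/-! ### The representation `V ⊗ U*` -/

section TensorDual

variable {k : Type u} [Field k] {H G : Type v} [Group H] [Group G]
    {V U : Type*} [AddCommGroup V] [Module k V] [AddCommGroup U] [Module k U]
    [Module.Finite k V] [Module.Finite k U]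
    (ρ : Representation k H V) (τ : Representation k G U)

/-- The image contains `T ⊗ 1` and `1 ⊗ T'`: in finite dimension every endomorphism of `U*` is a
transpose. Their products span `End(V ⊗ U*) = End V ⊗ End U*`. -/
theorem tensorDual_asAlgebraHom_surjective (hρ : Function.Surjective ρ.asAlgebraHom)
    (hτ : Function.Surjective τ.asAlgebraHom) :
    Function.Surjective (tensorDual ρ τ).asAlgebraHom := by
  have h1 : ∀ a, TensorProduct.map (ρ.asAlgebraHom a) (LinearMap.id : Module.Dual k U →ₗ[k] _) ∈
      (tensorDual ρ τ).asAlgebraHom.range := by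
    intro a
    induction a using MonoidAlgebra.induction_linear with
    | zero => simp
    | add x y hx hy =>
      rw [map_add, TensorProduct.map_add_left]
      exact add_mem hx hy
    | single h c =>
      rw [Representation.asAlgebraHom_single, TensorProduct.map_smul_left]
      refine Subalgebra.smul_mem _ (AlgHom.mem_range _ |>.2 ⟨MonoidAlgebra.single (h, 1) 1, ?_⟩) _
      rw [Representation.asAlgebraHom_single_one]
      change TensorProduct.map (ρ h) (τ.dual 1) = _
      rw [map_one]
      rfl
  have h2 : ∀ a, TensorProduct.map (LinearMap.id : V →ₗ[k] V)
      (Module.Dual.transpose (R := k) (τ.asAlgebraHom a)) ∈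
      (tensorDual ρ τ).asAlgebraHom.range := by
    intro a
    induction a using MonoidAlgebra.induction_linear with
    | zero => simp
    | add x y hx hy =>
      rw [map_add, map_add, TensorProduct.map_add_right]
      exact add_mem hx hy
    | single g c =>
      rw [Representation.asAlgebraHom_single, map_smul, TensorProduct.map_smul_right]
      refine Subalgebra.smul_mem _ (AlgHom.mem_range _ |>.2 ⟨MonoidAlgebra.single (1, g⁻¹) 1, ?_⟩) _
      rw [Representation.asAlgebraHom_single_one]
      change TensorProduct.map (ρ 1) (τ.dual g⁻¹) = _
      rw [map_one, Representation.dual_apply, inv_inv]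
      rfl
  have h3 : ∀ T T', TensorProduct.map T T' ∈ (tensorDual ρ τ).asAlgebraHom.range := by
    intro T T'
    obtain ⟨a, rfl⟩ := hρ T
    obtain ⟨T'', rfl⟩ : ∃ T'', Module.Dual.transpose (R := k) T'' = T' := by
      refine ⟨((Module.evalEquiv k U).symm.toLinearMap ∘ₗ
        Module.Dual.transpose (R := k) T' ∘ₗ (Module.evalEquiv k U).toLinearMap), ?_⟩
      ext f x
      have := Module.apply_evalEquiv_symm_apply (R := k) (M := U) f
        (Module.Dual.transpose (R := k) T' (Module.evalEquiv k U x))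
      exact this
    obtain ⟨b, rfl⟩ := hτ T''
    have := mul_mem (h1 a) (h2 b)
    rwa [Module.End.mul_eq_comp, ← TensorProduct.map_comp, LinearMap.comp_id,
      LinearMap.id_comp] at this
  intro T
  obtain ⟨t, rfl⟩ := (homTensorHomEquiv k V (Module.Dual k U) V (Module.Dual k U)).surjective T
  rw [← AlgHom.mem_range]
  induction t using TensorProduct.induction_on with
  | zero => simp
  | add x y hx hy =>
    rw [map_add]
    exact add_mem hx hy
  | tmul T T' =>
    rw [homTensorHomEquiv_apply, TensorProduct.homTensorHomMap_apply]
    exact h3 T T'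

end TensorDual

/-! ### Multiplicities as dimensions of Hom spaces -/

section Multiplicity

variable {k : Type*} [Field k] {A : Type*} [Ring A] [Algebra k A]
variable {S : Type*} [AddCommGroup S] [Module k S] [Module A S] [IsScalarTower k A S]
variable {N : Type*} [AddCommGroup N] [Module A N]

open Classical in
theorem finrank_linearMap_of_isSimpleModule [IsSimpleModule A S] [IsSimpleModule A N]
    (hS : ∀ D : S →ₗ[A] S, ∃ c : k, ∀ x, D x = c • x) :
    Module.finrank k (N →ₗ[A] S) = if Nonempty (N ≃ₗ[A] S) then 1 else 0 := by
  split_ifs with h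
  · obtain ⟨φ⟩ := h
    rw [(φ.congrLeft S k).finrank_eq]
    have := IsSimpleModule.nontrivial A S
    refine finrank_eq_one LinearMap.id (fun h0 => ?_) fun D => ?_
    · obtain ⟨x, hx⟩ := exists_ne (0 : S)
      exact hx (LinearMap.congr_fun h0 x)
    · obtain ⟨c, hc⟩ := hS D
      exact ⟨c, LinearMap.ext fun x => (hc x).symm⟩
  · have : Subsingleton (N →ₗ[A] S) := ⟨fun f g => by
      have h0 : ∀ f : N →ₗ[A] S, f = 0 := fun f =>
        (LinearMap.bijective_or_eq_zero f).resolve_left fun hf =>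
          h ⟨LinearEquiv.ofBijective f hf⟩
      rw [h0 f, h0 g]⟩
    exact Module.finrank_zero_of_subsingleton

variable [Module k N] [IsScalarTower k A N]

theorem finite_linearMap_of_finite [Module.Finite k S] [Module.Finite k N] :
    Module.Finite k (N →ₗ[A] S) :=
  Module.Finite.of_injective (LinearMap.restrictScalarsₗ k A N S k)
    (LinearMap.restrictScalars_injective k)

theorem finrank_linearMap_eq_add [IsSemisimpleModule A N] [Module.Finite k S] [Module.Finite k N]
    (p : Submodule A N) : Module.finrank k (N →ₗ[A] S) =
      Module.finrank k (p →ₗ[A] S) + Module.finrank k ((N ⧸ p) →ₗ[A] S) := by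
  obtain ⟨q, hq⟩ := exists_isCompl p
  have : Module.Finite k p := Module.Finite.of_injective (p.subtype.restrictScalars k)
    Subtype.val_injective
  have : Module.Finite k q := Module.Finite.of_injective (q.subtype.restrictScalars k)
    Subtype.val_injective
  have := finite_linearMap_of_finite (k := k) (A := A) (S := S) (N := p)
  have := finite_linearMap_of_finite (k := k) (A := A) (S := S) (N := q)
  rw [((Submodule.prodEquivOfIsCompl p q hq).congrLeft S k).finrank_eq.symm,
    (LinearMap.coprodEquiv (R := A) (M := p) (M₂ := q) (M₃ := S) k).finrank_eq.symm,
    Module.finrank_prod, ((Submodule.quotientEquivOfIsCompl p q hq).congrLeft S k).finrank_eq]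

/-- Over a semisimple algebra the multiplicity of a simple module with scalar endomorphisms is the
dimension of a space of homomorphisms. -/
theorem constituentMultiplicity_eq_finrank [IsSemisimpleRing A] [IsSimpleModule A S]
    (hS : ∀ D : S →ₗ[A] S, ∃ c : k, ∀ x, D x = c • x) [Module.Finite k S] [Module.Finite k N] :
    constituentMultiplicity A S N = Module.finrank k (N →ₗ[A] S) := by
  classical
  have : Module.Finite A N := Module.Finite.of_restrictScalars_finite k A N
  have hex := (isFiniteLength_iff_exists_compositionSeries (R := A) (M := N)).1
    (isFiniteLength_iff_isNoetherian_isArtinian.2 ⟨inferInstance, inferInstance⟩)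
  unfold constituentMultiplicity
  rw [dif_pos hex]
  generalize hs : hex.choose = s
  obtain ⟨h0, h1⟩ : s.head = ⊥ ∧ s.last = ⊤ := by
    rw [← hs]
    exact hex.choose_spec
  have hfin : ∀ p : Submodule A N, Module.Finite k p := fun p =>
    Module.Finite.of_injective (p.subtype.restrictScalars k) Subtype.val_injective
  -- Climbing the series, each factor adds `1` or `0` to `dim Hom(s i, S)` by Schur, as submodules
  -- have complements.
  have key : ∀ i : Fin (s.length + 1), Module.finrank k (s i →ₗ[A] S) =
      (Finset.univ.filter fun j : Fin s.length => j.castSucc < i ∧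
        Nonempty (((s j.succ) ⧸ (s j.castSucc).submoduleOf (s j.succ)) ≃ₗ[A] S)).card := by
    intro i
    induction i using Fin.induction with
    | zero =>
      have h0' : s 0 = ⊥ := h0
      have : Subsingleton (s 0 →ₗ[A] S) := by
        rw [h0']
        infer_instance
      rw [Module.finrank_zero_of_subsingleton]
      simp
    | succ i ih =>
      have hlt : s i.castSucc ⋖ s i.succ := s.step i
      have := hfin (s i.succ)
      rw [finrank_linearMap_eq_add ((s i.castSucc).submoduleOf (s i.succ)),
        ((Submodule.submoduleOfEquivOfLe hlt.le).congrLeft S k).finrank_eq, ih]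
      have : IsSimpleModule A ((s i.succ) ⧸ (s i.castSucc).submoduleOf (s i.succ)) :=
        (covBy_iff_quot_is_simple hlt.le).1 hlt
      rw [finrank_linearMap_of_isSimpleModule hS]
      have hset : (Finset.univ.filter fun j : Fin s.length => j.castSucc < i.succ ∧
          Nonempty (((s j.succ) ⧸ (s j.castSucc).submoduleOf (s j.succ)) ≃ₗ[A] S)) =
          (Finset.univ.filter fun j : Fin s.length => j.castSucc < i.castSucc ∧
            Nonempty (((s j.succ) ⧸ (s j.castSucc).submoduleOf (s j.succ)) ≃ₗ[A] S)) ∪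
          (if Nonempty (((s i.succ) ⧸ (s i.castSucc).submoduleOf (s i.succ)) ≃ₗ[A] S)
            then {i} else ∅) := by
        ext j
        rw [Finset.mem_union, Finset.mem_filter, Finset.mem_filter]
        have hj : j.castSucc < i.succ ↔ j.castSucc < i.castSucc ∨ j = i := by
          rw [Fin.castSucc_lt_succ_iff, le_iff_lt_or_eq, Fin.castSucc_lt_castSucc_iff]
        rw [hj]
        by_cases hji : j = i
        · subst hji
          split_ifs with hiso <;> simp [hiso]
        · split_ifs with hiso <;> simp [hji]
      rw [hset, Finset.card_union_of_disjoint]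
      · split_ifs <;> simp
      · rw [Finset.disjoint_left]
        intro j hj hj'
        split_ifs at hj'
        · rw [Finset.mem_singleton] at hj'
          subst hj'
          simp at hj
        · simp at hj'
  have htop : Module.finrank k (N →ₗ[A] S) = Module.finrank k (s (Fin.last _) →ₗ[A] S) := by
    have : s (Fin.last _) = ⊤ := h1
    rw [this]
    exact ((Submodule.topEquiv (R := A) (M := N)).congrLeft S k).finrank_eq.symm
  rw [htop, key, Nat.card_eq_fintype_card, Fintype.card_subtype]
  congr 1
  ext j
  simp [Fin.castSucc_lt_last]

end Multiplicity

/-! ### Apex of an inflated module -/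

section Inflation

variable {k : Type u} [Field k] {M : Type v} [Monoid M]

theorem SimpleMod.rep_apply {G : Type v} [Monoid G] (U : SimpleMod k[G]) (g : G) (x : U.1) :
    U.rep g x = MonoidAlgebra.single g (1 : k) • x := rfl

theorem SimpleMod.asAlgebraHom_rep {G : Type v} [Monoid G] (U : SimpleMod k[G]) :
    U.rep.asAlgebraHom = Algebra.lsmul k k U.1 :=
  (MonoidAlgebra.lift k _ G).apply_symm_apply _

theorem SimpleMod.finite {A : Type w} [Ring A] [Algebra k A] [Module.Finite k A]
    (U : SimpleMod A) : Module.Finite k U.1 := by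
  have := U.2
  have : Module.Finite A U.1 := inferInstance
  exact Module.Finite.trans A U.1

theorem SimpleMod.asAlgebraHom_rep_surjective {G : Type v} [Monoid G] [Finite G]
    (h : SplitsOver k k[G]) (U : SimpleMod k[G]) :
    Function.Surjective U.rep.asAlgebraHom := by
  have := U.2
  have := SimpleMod.finite (k := k) U
  rw [U.asAlgebraHom_rep]
  exact h.lsmul_surjective

theorem Idem.IsApex.of_rep_coe {S : Type*} [AddCommGroup S] [Module k S]
    {ρ : Representation k M S} {e : Idem M} (h : e.IsApex ρ) (m : M) :
    ρ (e.1 * m * e.1) = ρ m := by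
  rw [map_mul, map_mul, h.1]
  rfl

theorem IsInflation.isApex {e : Idem M} {U : SimpleMod k[e.maxSubgroup]} {S : SimpleMod k[M]}
    (h : IsInflation e U S) : e.IsApex S.rep := by
  obtain ⟨φ, hφ⟩ := h
  refine ⟨?_, fun m hm => LinearMap.ext fun x => (hφ m).2 hm x⟩
  obtain ⟨g, hg, hgx⟩ := (hφ e.1).1 (Idem.LeJ.refl e)
  have : g = 1 := Idem.coeMaxSubgroup_injective (by
    rw [hg, e.mul_self, e.mul_self, Idem.coeMaxSubgroup_one])
  subst this
  refine LinearMap.ext fun x => φ.injective ?_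
  rw [hgx, map_one]
  rfl

theorem IsInflation.exists_equiv {e : Idem M} {U : SimpleMod k[e.maxSubgroup]} {S : SimpleMod k[M]}
    (h : IsInflation e U S) : ∃ φ : S.1 ≃ₗ[k] U.1,
      ∀ g x, φ (S.rep (Idem.coeMaxSubgroup g) x) = U.rep g (φ x) := by
  obtain ⟨φ, hφ⟩ := h
  refine ⟨φ, fun g x => ?_⟩
  obtain ⟨g', hg, hgx⟩ := (hφ (Idem.coeMaxSubgroup g)).1 (Idem.leJ_coeMaxSubgroup g)
  rw [Idem.mul_coeMaxSubgroup, Idem.coeMaxSubgroup_mul_self] at hg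
  rw [hgx, Idem.coeMaxSubgroup_injective hg]

end Inflation

/-! ### Intertwiners from the permutation module -/

section IrrMor

variable {k : Type u} [Field k] {M : Type v} [Monoid M] {e f : Idem M}

theorem IrrMor.smul_f (p : f.maxSubgroup × e.maxSubgroup) (x : IrrMor e.toKaroubi f.toKaroubi) :
    (p • x).1.f = Idem.coeMaxSubgroup p.1 * (show M from x.1.f) * Idem.coeMaxSubgroup p.2⁻¹ := rfl

theorem IrrMor.ext_f {x y : IrrMor e.toKaroubi f.toKaroubi} (h : x.1.f = y.1.f) : x = y :=
  Subtype.ext (Karoubi.hom_ext _ _ h)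

variable (hM : IsDG M)

/-- The irreducible morphism of the Karoubi envelope given by an element of `f M e`. -/
def Idem.IsIrr.toIrrMor {m : M} (h : Idem.IsIrr e f m) : IrrMor e.toKaroubi f.toKaroubi :=
  ⟨Idem.karoubiHom e f m h.1 h.2.1, (Idem.isIrreducibleMorphism_iff hM _).2 h⟩

include hM in
theorem IrrMor.isIrr (x : IrrMor e.toKaroubi f.toKaroubi) : Idem.IsIrr e f x.1.f :=
  (Idem.isIrreducibleMorphism_iff hM _).1 x.2

instance IrrMor.finite [Finite M] : Finite (IrrMor e.toKaroubi f.toKaroubi) :=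
  Finite.of_injective (fun x => (show M from x.1.f)) fun _ _ h => IrrMor.ext_f h

variable {S T W : Type*} [AddCommGroup S] [Module k S] [AddCommGroup T] [Module k T]
  [AddCommGroup W] [Module k W] {ρ : Representation k M S} {σ : Representation k M T}
  (hρ : e.IsApex ρ) (hσ : f.IsApex σ)
  {ω : Representation k (f.maxSubgroup × e.maxSubgroup) W} (ψ : W ≃ₗ[k] (S →ₗ[k] T))
  (hψ : ∀ p w, ψ (ω p w) =
    σ (Idem.coeMaxSubgroup p.1) ∘ₗ ψ w ∘ₗ ρ (Idem.coeMaxSubgroup p.2⁻¹))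

include hρ hσ hψ

open Classical in
/-- Intertwining maps from the permutation module of irreducible morphisms as equivariant
functions. -/
noncomputable def intertwiningToIrrEquivariantMaps :
    (irrPermutationRep k e f).IntertwiningMap ω →ₗ[k] irrEquivariantMaps ρ σ e f where
  toFun Λ := ⟨fun m => if h : Idem.IsIrr e f m then
      ψ (Λ (MonoidAlgebra.single (h.toIrrMor hM) 1)) else 0, fun m hm => dif_neg hm,
    fun a b ha hb m hm hm' => by
      beta_reduce
      by_cases h : Idem.IsIrr e f m
      · have h' := h.mul hM ha hb
        rw [dif_pos h', dif_pos h]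
        obtain ⟨g, hg⟩ := ha.exists_maxSubgroup hM
        obtain ⟨l, hl⟩ := hb.exists_maxSubgroup hM
        -- As `m = fme`, only `faf` and `ebe` matter; the second entry is `l⁻¹` because the action
        -- inverts it.
        have hx : h'.toIrrMor hM = (g, l⁻¹) • h.toIrrMor hM := IrrMor.ext_f <| by
          rw [IrrMor.smul_f, inv_inv]
          change a * m * b = Idem.coeMaxSubgroup g * m * Idem.coeMaxSubgroup l
          calc a * m * b = a * (f.1 * m * e.1) * b := by rw [hm, hm']
            _ = (a * f.1) * m * (e.1 * b) := by simp only [mul_assoc]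
            _ = (f.1 * a * f.1) * m * (e.1 * b * e.1) := by
              rw [ha.comm hM, mul_assoc a f.1 f.1, f.mul_self, mul_assoc e.1, ← hb.comm hM,
                e.mul_self_assoc]
            _ = _ := by rw [hg, hl]
        have hs : MonoidAlgebra.single (h'.toIrrMor hM) (1 : k) = irrPermutationRep k e f (g, l⁻¹)
            (MonoidAlgebra.single (h.toIrrMor hM) 1) := by
          rw [hx]
          exact (Representation.ofMulAction_single _ _ _).symm
        rw [hs, Λ.isIntertwining, hψ, inv_inv, hg, hl, hρ.of_rep_coe, hσ.of_rep_coe]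
      · have h' : ¬ Idem.IsIrr e f (a * m * b) := fun h' =>
          h ((Idem.isIrr_mul_iff hM hm hm' ha hb).1 h')
        rw [dif_neg h', dif_neg h]
        simp⟩
  map_add' Λ Λ' := by
    ext m : 2
    by_cases h : Idem.IsIrr e f m <;> simp [h]
  map_smul' c Λ := by
    ext m : 2
    by_cases h : Idem.IsIrr e f m <;> simp [h]

/-- The irreducible morphisms are a basis of the permutation module, so an intertwiner is an
equivariant function on them. -/
theorem intertwiningToIrrEquivariantMaps_bijective :
    Function.Bijective (intertwiningToIrrEquivariantMaps hM hρ hσ ψ hψ) := by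
  classical
  constructor
  · intro Λ Λ' h
    apply Representation.IntertwiningMap.ext
    ext x
    have hx := IrrMor.isIrr hM x
    have hm := congrFun (congrArg Subtype.val h) x.1.f
    change (if h : Idem.IsIrr e f x.1.f then
      ψ (Λ (MonoidAlgebra.single (h.toIrrMor hM) 1)) else 0) = (if h : Idem.IsIrr e f x.1.f then
      ψ (Λ' (MonoidAlgebra.single (h.toIrrMor hM) 1)) else 0) at hm
    rw [dif_pos hx, dif_pos hx] at hm
    exact ψ.injective hm
  · rintro ⟨F, hF0, hF⟩
    let L : k[IrrMor e.toKaroubi f.toKaroubi] →ₗ[k] W :=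
      Finsupp.linearCombination k (fun x : IrrMor e.toKaroubi f.toKaroubi => ψ.symm (F x.1.f)) ∘ₗ
        (MonoidAlgebra.coeffLinearEquiv k).toLinearMap
    have hL : ∀ x c, L (MonoidAlgebra.single x c) = c • ψ.symm (F x.1.f) := fun x c => by
      simp [L, MonoidAlgebra.coeffLinearEquiv]
    refine ⟨⟨L, fun p => ?_⟩, ?_⟩
    · ext x
      change L (irrPermutationRep k e f p (MonoidAlgebra.single x 1)) =
        ω p (L (MonoidAlgebra.single x 1))
      have hs : irrPermutationRep k e f p (MonoidAlgebra.single x 1) =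
          MonoidAlgebra.single (p • x) 1 := Representation.ofMulAction_single _ _ _
      rw [hs, hL, hL, one_smul, one_smul, IrrMor.smul_f]
      apply ψ.injective
      rw [hψ, LinearEquiv.apply_symm_apply, LinearEquiv.apply_symm_apply]
      exact hF _ _ (Idem.leJ_coeMaxSubgroup _) (Idem.leJ_coeMaxSubgroup _) _
        (Idem.karoubi_mul_hom x.1) (Idem.karoubi_hom_mul x.1)
    · ext m : 2
      change (if h : Idem.IsIrr e f m then
        ψ (L (MonoidAlgebra.single (h.toIrrMor hM) 1)) else 0) = F m
      split_ifs with h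
      · rw [hL, one_smul, LinearEquiv.apply_symm_apply]
        rfl
      · exact (hF0 m h).symm

end IrrMor

/-! ### Dimension of `Ext¹` between simple modules -/

section Arrows

variable {k : Type u} [Field k] {M : Type v} [Monoid M] [Finite M]

/-- The identification of `V ⊗ U*` with `Hom(S, T)` for inflations `S` of `U` and `T` of `V`. -/
theorem exists_tensorDual_equiv {e f : Idem M} {U : SimpleMod k[e.maxSubgroup]}
    {V : SimpleMod k[f.maxSubgroup]} {S T : SimpleMod k[M]} (hS : IsInflation e U S)
    (hT : IsInflation f V T) :
    ∃ ψ : (V.1 ⊗[k] Module.Dual k U.1) ≃ₗ[k] (S.1 →ₗ[k] T.1), ∀ p w,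
      ψ (tensorDual V.rep U.rep p w) = T.rep (Idem.coeMaxSubgroup p.1) ∘ₗ
        ψ w ∘ₗ S.rep (Idem.coeMaxSubgroup p.2⁻¹) := by
  obtain ⟨φ, hφ⟩ := hS.exists_equiv
  obtain ⟨χ, hχ⟩ := hT.exists_equiv
  have : Module.Finite k U.1 := SimpleMod.finite U
  let ψ := TensorProduct.comm k V.1 (Module.Dual k U.1) ≪≫ₗ dualTensorHomEquiv k U.1 V.1 ≪≫ₗ
    LinearEquiv.arrowCongr φ.symm χ.symm
  have hψ : ∀ v u s, ψ (v ⊗ₜ u) s = u (φ s) • χ.symm v := fun v u s => by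
    change χ.symm (u (φ s) • v) = _
    rw [map_smul]
  refine ⟨ψ, fun p w => ?_⟩
  induction w using TensorProduct.induction_on with
  | zero => simp
  | add x y hx hy => rw [map_add, map_add, map_add, hx, hy, LinearMap.add_comp, LinearMap.comp_add]
  | tmul v u =>
    ext s
    have h1 : tensorDual V.rep U.rep p (v ⊗ₜ u) = V.rep p.1 v ⊗ₜ U.rep.dual p.2 u := rfl
    have h2 : χ.symm (V.rep p.1 v) = T.rep (Idem.coeMaxSubgroup p.1) (χ.symm v) :=
      χ.injective (by rw [hχ, LinearEquiv.apply_symm_apply, LinearEquiv.apply_symm_apply])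
    rw [h1, hψ, LinearMap.comp_apply, LinearMap.comp_apply, hψ, map_smul, h2, hφ]
    rfl

variable (hM : IsDG M)
  (hsplit : ∀ e : Idem M, SplitsOver k k[e.maxSubgroup])
  (hchar : ∀ e : Idem M, ¬ ringChar k ∣ Nat.card e.maxSubgroup)

include hsplit in
theorem tensorDual_rep_surjective {e f : Idem M} (U : SimpleMod k[e.maxSubgroup])
    (V : SimpleMod k[f.maxSubgroup]) :
    Function.Surjective (Algebra.lsmul k k (tensorDual V.rep U.rep).asModule :
      k[f.maxSubgroup × e.maxSubgroup] →ₐ[k] _) := by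
  have : Module.Finite k U.1 := SimpleMod.finite U
  have : Module.Finite k V.1 := SimpleMod.finite V
  exact tensorDual_asAlgebraHom_surjective V.rep U.rep
    (SimpleMod.asAlgebraHom_rep_surjective (hsplit f) V)
    (SimpleMod.asAlgebraHom_rep_surjective (hsplit e) U)

instance nontrivial_tensorDual {e f : Idem M} (U : SimpleMod k[e.maxSubgroup])
    (V : SimpleMod k[f.maxSubgroup]) : Nontrivial (tensorDual V.rep U.rep).asModule := by
  have := U.2
  have := V.2
  have : Nontrivial U.1 := IsSimpleModule.nontrivial k[e.maxSubgroup] U.1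
  have : Nontrivial V.1 := IsSimpleModule.nontrivial k[f.maxSubgroup] V.1
  change Nontrivial (V.1 ⊗[k] Module.Dual k U.1)
  infer_instance

include hsplit in
theorem tensorDual_isIrreducible {e f : Idem M} (U : SimpleMod k[e.maxSubgroup])
    (V : SimpleMod k[f.maxSubgroup]) : (tensorDual V.rep U.rep).IsIrreducible := by
  rw [Representation.irreducible_iff_isSimpleModule_asModule]
  exact isSimpleModule_of_lsmul_surjective (tensorDual_rep_surjective hsplit U V)

include hM hsplit hchar

open CategoryTheory.Abelian in
theorem extOne_finite_and_finrank_eq {e f : Idem M} {U : SimpleMod k[e.maxSubgroup]}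
    {V : SimpleMod k[f.maxSubgroup]} {S T : SimpleMod k[M]} (hS : IsInflation e U S)
    (hT : IsInflation f V T) :
    Module.Finite k (Ext S.1 T.1 1) ∧ Module.finrank k (Ext S.1 T.1 1) =
      constituentMultiplicity k[f.maxSubgroup × e.maxSubgroup]
        (tensorDual V.rep U.rep).asModule (irrPermutationRep k e f).asModule := by
  have hcard : ∀ e : Idem M, (Nat.card e.maxSubgroup : k) ≠ 0 := fun e h =>
    hchar e ((ringChar.spec k _).1 h)
  have : NeZero (Nat.card (f.maxSubgroup × e.maxSubgroup) : k) := ⟨by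
    rw [Nat.card_prod, Nat.cast_mul]
    exact mul_ne_zero (hcard f) (hcard e)⟩
  have : Module.Finite k U.1 := SimpleMod.finite U
  have : Module.Finite k V.1 := SimpleMod.finite V
  have : IsSimpleModule k[f.maxSubgroup × e.maxSubgroup] (tensorDual V.rep U.rep).asModule :=
    isSimpleModule_of_lsmul_surjective (tensorDual_rep_surjective hsplit U V)
  obtain ⟨ψ, hψ⟩ := exists_tensorDual_equiv hS hT
  obtain ⟨Θ⟩ := nonempty_extOne_equiv hM S.1 T.1 hS.isApex hT.isApex (hcard e)
  let Ξ := Θ ≪≫ₗ (LinearEquiv.ofBijective _ (intertwiningToIrrEquivariantMaps_bijective hM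
    hS.isApex hT.isApex ψ hψ)).symm ≪≫ₗ Representation.IntertwiningMap.equivLinearMapAsModule _ _
  have := finite_linearMap_of_finite (k := k) (A := k[f.maxSubgroup × e.maxSubgroup])
    (S := (tensorDual V.rep U.rep).asModule) (N := (irrPermutationRep k e f).asModule)
  refine ⟨Module.Finite.equiv Ξ.symm, ?_⟩
  rw [constituentMultiplicity_eq_finrank (k := k)
    (exists_smul_eq_of_lsmul_surjective (tensorDual_rep_surjective hsplit U V)), Ξ.finrank_eq]

end Arrows

/-! ### Simple modules and representations -/

section SimpleModules

variable {k : Type u} [Field k] {G : Type v} [Monoid G]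

theorem SimpleMod.nonempty_iso_iff (S T : SimpleMod k[G]) :
    Nonempty (S.1 ≅ T.1) ↔ ∃ φ : S.1 ≃ₗ[k] T.1, ∀ m x, φ (S.rep m x) = T.rep m (φ x) := by
  constructor
  · rintro ⟨i⟩
    exact ⟨i.toLinearEquiv.restrictScalars k, fun m x => map_smul i.toLinearEquiv _ x⟩
  · rintro ⟨φ, hφ⟩
    refine ⟨LinearEquiv.toModuleIso
      { φ with
        map_smul' := fun a x => ?_ }⟩
    change φ (a • x) = a • φ x
    induction a using MonoidAlgebra.induction_linear with
    | zero => simp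
    | add a b ha hb => simp only [add_smul, map_add, ha, hb]
    | single m c =>
      have h1 : ∀ (N : ModuleCat.{max u v} k[G]) (x : N),
          (MonoidAlgebra.single m c : k[G]) • x = c • MonoidAlgebra.single m (1 : k) • x := by
        intro N x
        rw [← smul_assoc, MonoidAlgebra.smul_single, smul_eq_mul, mul_one]
      rw [h1, h1, map_smul]
      exact congrArg (c • ·) (hφ m x)

theorem SimpleMod.cls_eq_iff {A : Type w} [Ring A] {S T : SimpleMod A} :
    S.cls = T.cls ↔ Nonempty (S.1 ≅ T.1) :=
  Quotient.eq (r := SimpleMod.setoid A)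

theorem ModuleCat.exists_linearEquiv_of_addEquiv {A : Type*} [Ring A] [Algebra k A]
    {V : Type*} [AddCommGroup V] [Module k V] (N : ModuleCat A) (ψ : V ≃+ N)
    (hψ : ∀ (c : k) x, ψ (c • x) = algebraMap k A c • ψ x) :
    ∃ φ : V ≃ₗ[k] N, ∀ x, φ x = ψ x :=
  ⟨{ ψ with map_smul' := hψ }, fun _ => rfl⟩

theorem exists_simpleMod_of_rep {V : Type max u v} [AddCommGroup V] [Module k V]
    (ρ : Representation k G V) (h : IsSimpleModule k[G] ρ.asModule) :
    ∃ (U : SimpleMod k[G]) (φ : V ≃ₗ[k] U.1), ∀ g x, φ (ρ g x) = U.rep g (φ x) := by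
  obtain ⟨φ, hφ⟩ := ModuleCat.exists_linearEquiv_of_addEquiv (k := k)
    (ModuleCat.of k[G] ρ.asModule) (AddEquiv.refl V) (fun c x => by
      change c • x = ρ.asAlgebraHom (algebraMap k _ c) x
      rw [AlgHom.commutes]
      rfl)
  refine ⟨⟨ModuleCat.of k[G] ρ.asModule, h⟩, φ, fun g x => ?_⟩
  refine (hφ _).trans (Eq.trans ?_ (congrArg (MonoidAlgebra.single g (1 : k) • ·) (hφ x).symm))
  change ρ g x = ρ.asAlgebraHom (MonoidAlgebra.single g 1) x
  rw [Representation.asAlgebraHom_single_one]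

end SimpleModules

/-! ### The homomorphisms `k[M] → k[G_e]` and inflation -/

section Retraction

variable (k : Type u) [Field k] {M : Type v} [Monoid M] (hM : IsDG M)

open Classical in
/-- The homomorphism `k[M] → k[G_e]` that sends `m` to `e m e` if `e ∈ M m M` and to `0`
otherwise. -/
noncomputable def apexHom (e : Idem M) : k[M] →ₐ[k] k[e.maxSubgroup] :=
  MonoidAlgebra.lift k _ M
    { toFun := fun m => if h : e.LeJ m then MonoidAlgebra.single (h.exists_maxSubgroup hM).choose 1
        else 0
      map_one' := by
        rw [dif_pos (Idem.LeJ.one e), MonoidAlgebra.one_def]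
        congr 1
        apply Idem.coeMaxSubgroup_injective
        rw [((Idem.LeJ.one e).exists_maxSubgroup hM).choose_spec, mul_one, e.mul_self,
          Idem.coeMaxSubgroup_one]
      map_mul' := fun m n => by
        by_cases hm : e.LeJ m
        · by_cases hn : e.LeJ n
          · rw [dif_pos (hm.mul hM hn), dif_pos hm, dif_pos hn, MonoidAlgebra.single_mul_single,
              mul_one]
            congr 1
            apply Idem.coeMaxSubgroup_injective
            rw [Idem.coeMaxSubgroup_mul, (hm.exists_maxSubgroup hM).choose_spec,
              (hn.exists_maxSubgroup hM).choose_spec,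
              ((hm.mul hM hn).exists_maxSubgroup hM).choose_spec]
            have h : e.1 * (n * e.1) = n * e.1 := by
              rw [← mul_assoc, hn.comm hM, mul_assoc, e.mul_self]
            simp only [mul_assoc, h]
          · rw [dif_neg fun h => hn h.right, dif_neg hn, mul_zero]
        · rw [dif_neg fun h => hm h.left, dif_neg hm, zero_mul] }

variable {k}

theorem apexHom_single_of_not_leJ {e : Idem M} {m : M} (h : ¬ e.LeJ m) (c : k) :
    apexHom k hM e (MonoidAlgebra.single m c) = 0 := by
  classical
  rw [apexHom, MonoidAlgebra.lift_single]
  change c • (dite _ _ _) = _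
  rw [dif_neg h, smul_zero]

theorem apexHom_single_of_leJ {e : Idem M} {m : M} (h : e.LeJ m) :
    ∃ g : e.maxSubgroup, Idem.coeMaxSubgroup g = e.1 * m * e.1 ∧
      ∀ c : k, apexHom k hM e (MonoidAlgebra.single m c) = MonoidAlgebra.single g c := by
  classical
  refine ⟨_, (h.exists_maxSubgroup hM).choose_spec, fun c => ?_⟩
  rw [apexHom, MonoidAlgebra.lift_single]
  change c • (dite _ _ _) = _
  rw [dif_pos h, MonoidAlgebra.smul_single, smul_eq_mul, mul_one]

theorem apexHom_single_coe {e : Idem M} (g : e.maxSubgroup) (c : k) :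
    apexHom k hM e (MonoidAlgebra.single (Idem.coeMaxSubgroup g) c) = MonoidAlgebra.single g c := by
  obtain ⟨g', hg, h⟩ := apexHom_single_of_leJ (k := k) hM (Idem.leJ_coeMaxSubgroup g)
  rw [Idem.mul_coeMaxSubgroup, Idem.coeMaxSubgroup_mul_self] at hg
  rw [h, Idem.coeMaxSubgroup_injective hg]

theorem apexHom_surjective (e : Idem M) : Function.Surjective (apexHom k hM e) := by
  intro b
  rw [← AlgHom.mem_range]
  induction b using MonoidAlgebra.induction_linear with
  | zero => exact zero_mem _
  | add x y hx hy => exact add_mem hx hy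
  | single g c => exact ⟨_, apexHom_single_coe hM g c⟩

/-- The inflation of a simple `k[G_e]`-module to `k[M]`. -/
noncomputable def SimpleMod.inflate {e : Idem M} (U : SimpleMod k[e.maxSubgroup]) :
    SimpleMod k[M] :=
  ⟨(ModuleCat.restrictScalars (apexHom k hM e).toRingHom).obj U.1, by
    have := U.2
    rw [isSimpleModule_iff_toSpanSingleton_surjective] at this ⊢
    refine ⟨this.1, fun x hx y => ?_⟩
    obtain ⟨b, hb⟩ := this.2 x hx y
    obtain ⟨a, rfl⟩ := apexHom_surjective hM e b
    exact ⟨a, hb⟩⟩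

theorem SimpleMod.isInflation_inflate {e : Idem M} (U : SimpleMod k[e.maxSubgroup]) :
    IsInflation e U (U.inflate hM) := by
  let φ : (U.inflate hM).1 ≃ₗ[k] U.1 :=
    { AddEquiv.refl U.1 with
      map_smul' := fun c x => by
        change apexHom k hM e (algebraMap k k[M] c) • (show U.1 from x) = _
        rw [AlgHom.commutes]
        rfl }
  refine ⟨φ, fun m => ⟨fun h => ?_, fun h x => ?_⟩⟩
  · obtain ⟨g, hg, hgm⟩ := apexHom_single_of_leJ (k := k) hM h
    refine ⟨g, hg, fun x => ?_⟩
    change apexHom k hM e (MonoidAlgebra.single m 1) • (show U.1 from x) = _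
    rw [hgm]
    rfl
  · change apexHom k hM e (MonoidAlgebra.single m 1) • (show U.1 from x) = 0
    rw [apexHom_single_of_not_leJ hM h, zero_smul]

end Retraction

/-! ### Classification of the simple `k[M]`-modules -/

section Classification

variable {k : Type u} [Field k] {M : Type v} [Monoid M] {e e' : Idem M}
  {U : SimpleMod k[e.maxSubgroup]} {U' : SimpleMod k[e'.maxSubgroup]} {S S' : SimpleMod k[M]}

theorem IsInflation.of_iso (h : IsInflation e U S) (i : Nonempty (S.1 ≅ S'.1)) :
    IsInflation e U S' := by
  obtain ⟨φ, hφ⟩ := h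
  obtain ⟨ψ, hψ⟩ := (SimpleMod.nonempty_iso_iff S S').1 i
  have hψ' : ∀ m x, ψ.symm (S'.rep m x) = S.rep m (ψ.symm x) := fun m x =>
    ψ.injective (by rw [hψ, LinearEquiv.apply_symm_apply, LinearEquiv.apply_symm_apply])
  refine ⟨ψ.symm ≪≫ₗ φ, fun m => ⟨fun hm => ?_, fun hm x => ψ.symm.injective ?_⟩⟩
  · obtain ⟨g, hg, hgx⟩ := (hφ m).1 hm
    refine ⟨g, hg, fun x => ?_⟩
    rw [LinearEquiv.trans_apply, LinearEquiv.trans_apply, hψ', hgx]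
  · rw [hψ', (hφ m).2 hm, map_zero]

theorem IsInflation.of_iso_source {U' : SimpleMod k[e.maxSubgroup]} (h : IsInflation e U S)
    (i : Nonempty (U.1 ≅ U'.1)) : IsInflation e U' S := by
  obtain ⟨φ, hφ⟩ := h
  obtain ⟨ψ, hψ⟩ := (SimpleMod.nonempty_iso_iff U U').1 i
  refine ⟨φ ≪≫ₗ ψ, fun m => ⟨fun hm => ?_, (hφ m).2⟩⟩
  obtain ⟨g, hg, hgx⟩ := (hφ m).1 hm
  refine ⟨g, hg, fun x => ?_⟩
  rw [LinearEquiv.trans_apply, LinearEquiv.trans_apply, hgx, hψ]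

theorem IsInflation.nonempty_iso (h : IsInflation e U S) (h' : IsInflation e U S') :
    Nonempty (S.1 ≅ S'.1) := by
  obtain ⟨φ, hφ⟩ := h
  obtain ⟨ψ, hψ⟩ := h'
  refine (SimpleMod.nonempty_iso_iff S S').2 ⟨φ ≪≫ₗ ψ.symm, fun m x => ψ.injective ?_⟩
  rw [LinearEquiv.trans_apply, LinearEquiv.trans_apply, LinearEquiv.apply_symm_apply]
  by_cases hm : e.LeJ m
  · obtain ⟨g, hg, hgx⟩ := (hφ m).1 hm
    obtain ⟨g', hg', hgx'⟩ := (hψ m).1 hm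
    rw [hgx, hgx', LinearEquiv.apply_symm_apply,
      Idem.coeMaxSubgroup_injective (hg.trans hg'.symm)]
  · rw [(hφ m).2 hm, (hψ m).2 hm, map_zero, map_zero]

theorem IsInflation.nonempty_iso_source {U' : SimpleMod k[e.maxSubgroup]} (h : IsInflation e U S)
    (h' : IsInflation e U' S) : Nonempty (U.1 ≅ U'.1) := by
  obtain ⟨φ, hφ⟩ := h.exists_equiv
  obtain ⟨ψ, hψ⟩ := h'.exists_equiv
  refine (SimpleMod.nonempty_iso_iff U U').2 ⟨φ.symm ≪≫ₗ ψ, fun g x => ?_⟩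
  have : φ.symm (U.rep g x) = S.rep (Idem.coeMaxSubgroup g) (φ.symm x) :=
    φ.injective (by rw [hφ, LinearEquiv.apply_symm_apply, LinearEquiv.apply_symm_apply])
  rw [LinearEquiv.trans_apply, LinearEquiv.trans_apply, this, hψ]

theorem SimpleMod.exists_ne_zero {A : Type w} [Ring A] (S : SimpleMod A) : ∃ x : S.1, x ≠ 0 := by
  have := S.2
  have := IsSimpleModule.nontrivial A S.1
  exact exists_ne 0

variable (hM : IsDG M)
include hM

/-- Each of the two apexes acts as the identity, hence not as zero, so each lies above the other. -/
theorem IsInflation.apex_eq (h : IsInflation e U S) (h' : IsInflation e' U' S) : e = e' := by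
  have key : ∀ {e e' : Idem M}, e.IsApex S.rep → e'.IsApex S.rep → e'.LeJ e.1 := by
    intro e e' h h'
    by_contra hcon
    obtain ⟨x, hx⟩ := S.exists_ne_zero
    apply hx
    have := h'.2 _ hcon
    rw [h.1] at this
    exact LinearMap.congr_fun this x
  exact (key h'.isApex h.isApex).antisymm hM (key h.isApex h'.isApex)

theorem IsInflation.exists_map_smul (h : IsInflation e U S) : ∃ φ : S.1 ≃ₗ[k] U.1,
    ∀ (a : k[M]) x, φ (a • x) = apexHom k hM e a • φ x := by
  obtain ⟨φ, hφ⟩ := h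
  refine ⟨φ, fun a x => ?_⟩
  induction a using MonoidAlgebra.induction_linear with
  | zero => simp
  | add a b ha hb => simp only [add_smul, map_add, ha, hb]
  | single m c =>
    have h1 : (MonoidAlgebra.single m c : k[M]) = c • MonoidAlgebra.single m (1 : k) := by
      rw [MonoidAlgebra.smul_single, smul_eq_mul, mul_one]
    have h2 : φ (MonoidAlgebra.single m (1 : k) • x) =
        apexHom k hM e (MonoidAlgebra.single m (1 : k)) • φ x := by
      by_cases hm : e.LeJ m
      · obtain ⟨g, hg, hgx⟩ := (hφ m).1 hm
        obtain ⟨g', hg', hgm⟩ := apexHom_single_of_leJ (k := k) hM hm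
        rw [hgm, Idem.coeMaxSubgroup_injective (hg'.trans hg.symm)]
        exact hgx x
      · rw [apexHom_single_of_not_leJ hM hm, zero_smul]
        exact (congrArg φ ((hφ m).2 hm x)).trans (map_zero φ)
    rw [h1, smul_assoc, φ.map_smul, h2, map_smul (apexHom k hM e), smul_assoc]

/-- Every simple `k[M]`-module is the inflation of a simple module of a maximal subgroup. -/
theorem exists_isInflation [Finite M] (S : SimpleMod k[M]) :
    ∃ (e : Idem M) (U : SimpleMod k[e.maxSubgroup]), IsInflation e U S := by
  have hsimple := (isSimpleModule_iff_toSpanSingleton_surjective.1 S.2).2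
  obtain ⟨x₀, hx₀⟩ := S.exists_ne_zero
  -- The annihilator of `S` in `M` is prime: if `b` does not kill `S`, then some `bs ≠ 0` generates
  -- `S`, so `aMb = 0` on `S` forces `a = 0` on `S`.
  obtain ⟨e, he⟩ := exists_idem_of_prime_ideal {m : M | S.rep m = 0}
    (fun h => hx₀ <| by
      have : S.rep 1 = 0 := by
        change (1 : M) ∈ {m : M | S.rep m = 0}
        rw [h]
        trivial
      rw [map_one] at this
      exact LinearMap.congr_fun this x₀)
    (fun a m (hm : S.rep m = 0) => by
      change S.rep (a * m) = 0
      rw [map_mul, hm, mul_zero])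
    (fun a m (hm : S.rep m = 0) => by
      change S.rep (m * a) = 0
      rw [map_mul, hm, zero_mul])
    (fun a b (ha : ¬ S.rep a = 0) (hb : ¬ S.rep b = 0) => by
      by_contra! hcon
      obtain ⟨s, hs⟩ : ∃ s, S.rep b s ≠ 0 := by
        by_contra! h
        exact hb (LinearMap.ext h)
      refine ha (LinearMap.ext fun t => ?_)
      obtain ⟨c, hc⟩ := hsimple _ hs t
      rw [← hc, LinearMap.toSpanSingleton_apply, LinearMap.zero_apply]
      clear hc
      induction c using MonoidAlgebra.induction_linear with
      | zero => rw [zero_smul, map_zero]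
      | add x y hx hy => rw [add_smul, map_add, hx, hy, add_zero]
      | single m c =>
        have h1 : (MonoidAlgebra.single m c : k[M]) • S.rep b s = c • S.rep m (S.rep b s) := by
          rw [SimpleMod.rep_apply S m, ← smul_assoc, MonoidAlgebra.smul_single, smul_eq_mul,
            mul_one]
        have h2 : S.rep (a * m * b) = 0 := hcon m
        rw [h1, map_smul, ← Module.End.mul_apply, ← Module.End.mul_apply, ← map_mul, ← map_mul, h2,
          LinearMap.zero_apply, smul_zero])
  have he0 : ∀ m, ¬ e.LeJ m → S.rep m = 0 := fun m hm => (he m).2 hm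
  have hcomm : ∀ m, S.rep e.1 * S.rep m = S.rep m * S.rep e.1 := by
    intro m
    by_cases hm : e.LeJ m
    · rw [← map_mul, hm.comm hM, map_mul]
    · rw [he0 m hm, mul_zero, zero_mul]
  obtain ⟨s, hs⟩ : ∃ s, S.rep e.1 s ≠ 0 := by
    by_contra! h
    exact (he e.1).1 (LinearMap.ext h) (Idem.LeJ.refl e)
  -- The action of `e` commutes with `k[M]` and fixes `es ≠ 0`, which generates `S`.
  have heid : S.rep e.1 = LinearMap.id := by
    refine LinearMap.ext fun t => ?_
    obtain ⟨c, hc⟩ := hsimple _ hs t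
    rw [← hc, LinearMap.toSpanSingleton_apply, LinearMap.id_apply]
    clear hc
    induction c using MonoidAlgebra.induction_linear with
    | zero => rw [zero_smul, map_zero]
    | add x y hx hy => rw [add_smul, map_add, hx, hy]
    | single m c =>
      have h1 : (MonoidAlgebra.single m c : k[M]) • S.rep e.1 s = c • S.rep m (S.rep e.1 s) := by
        rw [SimpleMod.rep_apply S m, ← smul_assoc, MonoidAlgebra.smul_single, smul_eq_mul, mul_one]
      rw [h1, map_smul, ← Module.End.mul_apply, hcomm, Module.End.mul_apply,
        ← Module.End.mul_apply (S.rep e.1) (S.rep e.1), ← map_mul, e.mul_self]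
  have hapex : e.IsApex S.rep := ⟨heid, he0⟩
  let ρ : Representation k e.maxSubgroup S.1 :=
    { toFun := fun g => S.rep (Idem.coeMaxSubgroup g), map_one' := heid,
      map_mul' := fun g h => by rw [← map_mul, ← Idem.coeMaxSubgroup_mul] }
  -- The action of `k[M]` factors through `apexHom`, so simplicity over `k[M]` gives simplicity over
  -- `k[G_e]`.
  have hρ : ∀ (a : k[M]) (x : S.1), ρ.asAlgebraHom (apexHom k hM e a) x = a • x := by
    intro a x
    induction a using MonoidAlgebra.induction_linear with
    | zero => simp
    | add a b ha hb => rw [map_add, map_add, LinearMap.add_apply, ha, hb, add_smul]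
    | single m c =>
      have h1 : (MonoidAlgebra.single m c : k[M]) • x = c • S.rep m x := by
        rw [SimpleMod.rep_apply S m, ← smul_assoc, MonoidAlgebra.smul_single, smul_eq_mul, mul_one]
      rw [h1]
      by_cases hm : e.LeJ m
      · obtain ⟨g, hg, hgm⟩ := apexHom_single_of_leJ (k := k) hM hm
        rw [hgm, Representation.asAlgebraHom_single, ← hapex.of_rep_coe m, ← hg]
        rfl
      · rw [apexHom_single_of_not_leJ hM hm, he0 m hm]
        simp
  have hsimple' : IsSimpleModule k[e.maxSubgroup] ρ.asModule := by
    rw [isSimpleModule_iff_toSpanSingleton_surjective]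
    refine ⟨⟨x₀, 0, hx₀⟩, fun x hx y => ?_⟩
    obtain ⟨a, ha⟩ := hsimple x hx y
    exact ⟨apexHom k hM e a, (hρ a x).trans ha⟩
  obtain ⟨U, φ, hφ⟩ := exists_simpleMod_of_rep ρ hsimple'
  refine ⟨e, U, φ, fun m => ⟨fun hm => ?_, fun hm x => ?_⟩⟩
  · obtain ⟨g, hg⟩ := Idem.LeJ.exists_maxSubgroup hM hm
    refine ⟨g, hg, fun x => ?_⟩
    rw [← hφ, ← hapex.of_rep_coe m, ← hg]
    rfl
  · rw [he0 m hm, LinearMap.zero_apply]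

end Classification

/-! ### The radical of `k[M]` and its semisimple quotient -/

section Splitting

variable {k : Type u} [Field k] {M : Type v} [Monoid M] [Finite M] (hM : IsDG M)

instance Idem.finite : Finite (Idem M) := inferInstanceAs (Finite {e : M // IsIdempotentElem e})

variable (k) in
/-- The product of the homomorphisms `k[M] → k[G_e]`. -/
noncomputable def apexHomPi : k[M] →ₐ[k] ∀ e : Idem M, k[e.maxSubgroup] :=
  AlgHom.pi fun e => apexHom k hM e

/-- Triangularity: the image of `g ∈ G_e` has component `g` at `e`, and its other nonzero components
sit at idempotents `f < e`. Well-founded induction along this order removes them. -/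
theorem apexHomPi_surjective : Function.Surjective (apexHomPi k hM) := by
  classical
  have := Fintype.ofFinite (Idem M)
  let r : Idem M → Idem M → Prop := fun f e => f.LeJ e.1 ∧ f ≠ e
  have htrans : ∀ {a b c : Idem M}, a.LeJ b.1 → b.LeJ c.1 → a.LeJ c.1 := by
    rintro a b c h ⟨p, q, hpq⟩
    rw [← hpq] at h
    exact h.left.right
  have : IsTrans (Idem M) r := ⟨fun a b c hab hbc => ⟨htrans hab.1 hbc.1, by
    rintro rfl
    exact hab.2 (hab.1.antisymm hM hbc.1)⟩⟩
  have : Std.Irrefl r := ⟨fun a h => h.2 rfl⟩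
  have hwf : WellFounded r := Finite.wellFounded_of_trans_of_irrefl r
  have key : ∀ e : Idem M, ∀ g : e.maxSubgroup,
      Pi.single e (MonoidAlgebra.single g (1 : k)) ∈ (apexHomPi k hM).range := by
    intro e
    induction e using hwf.induction with
    | _ e ih =>
      intro g
      have h1 : apexHomPi k hM (MonoidAlgebra.single (Idem.coeMaxSubgroup g) 1) =
          ∑ f, Pi.single f (apexHom k hM f (MonoidAlgebra.single (Idem.coeMaxSubgroup g) 1)) :=
        (Finset.univ_sum_single _).symm
      rw [← Finset.add_sum_erase _ _ (Finset.mem_univ e), apexHom_single_coe,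
        ← sub_eq_iff_eq_add] at h1
      rw [← h1]
      refine sub_mem ⟨_, rfl⟩ (sum_mem fun f hf => ?_)
      by_cases hfe : f.LeJ (Idem.coeMaxSubgroup g)
      · obtain ⟨g', -, hg'⟩ := apexHom_single_of_leJ (k := k) hM hfe
        rw [hg']
        rw [← Idem.mul_coeMaxSubgroup] at hfe
        exact ih f ⟨hfe.left, Finset.ne_of_mem_erase hf⟩ g'
      · rw [apexHom_single_of_not_leJ hM hfe, Pi.single_zero]
        exact zero_mem _
  intro y
  rw [← AlgHom.mem_range, ← Finset.univ_sum_single y]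
  refine sum_mem fun e _ => ?_
  induction y e using MonoidAlgebra.induction_linear with
  | zero =>
    rw [Pi.single_zero]
    exact zero_mem _
  | add a b ha hb =>
    rw [Pi.single_add]
    exact add_mem ha hb
  | single g c =>
    have : (MonoidAlgebra.single g c : k[e.maxSubgroup]) = c • MonoidAlgebra.single g (1 : k) := by
      rw [MonoidAlgebra.smul_single, smul_eq_mul, mul_one]
    rw [this, Pi.single_smul]
    exact Subalgebra.smul_mem _ (key e g) c

/-- An element of the kernel kills every simple module, hence the class of `1` modulo each maximal
left ideal. Conversely, each `apexHom` is onto a semisimple ring and so kills the radical. -/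
theorem ker_apexHomPi [∀ e : Idem M, IsSemisimpleRing k[e.maxSubgroup]] :
    RingHom.ker (apexHomPi k hM) = Ring.jacobson k[M] := by
  refine le_antisymm (fun a ha => ?_) (fun a ha => ?_)
  · rw [Ring.jacobson_eq_sInf_isMaximal, Submodule.mem_sInf]
    intro I hI
    have hI' : IsSimpleModule k[M] (k[M] ⧸ I) :=
      isSimpleModule_iff_isCoatom.2 (Ideal.isMaximal_def.1 hI)
    obtain ⟨e, U, h⟩ := exists_isInflation hM ⟨ModuleCat.of k[M] (k[M] ⧸ I), hI'⟩
    obtain ⟨φ, hφ⟩ := h.exists_map_smul hM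
    have h1 : apexHom k hM e a = 0 := congrFun (RingHom.mem_ker.1 ha) e
    have h2 := hφ a (Submodule.Quotient.mk (p := I) (1 : k[M]))
    rw [h1, zero_smul] at h2
    have h3 : Submodule.Quotient.mk (p := I) (a • (1 : k[M])) = 0 := φ.injective (by
      rw [map_zero]
      exact h2)
    rwa [smul_eq_mul, mul_one, Submodule.Quotient.mk_eq_zero] at h3
  · rw [RingHom.mem_ker]
    refine funext fun e => ?_
    have : RingHomSurjective (apexHom k hM e).toRingHom := ⟨apexHom_surjective hM e⟩
    have h := Ring.le_comap_jacobson (apexHom k hM e).toRingHom ha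
    rw [IsSemisimpleRing.jacobson_eq_bot] at h
    exact h

include hM in
theorem splitsOver_monoidAlgebra (hsplit : ∀ e : Idem M, SplitsOver k k[e.maxSubgroup])
    [∀ e : Idem M, IsSemisimpleRing k[e.maxSubgroup]] : SplitsOver k k[M] := by
  classical
  have := Fintype.ofFinite (Idem M)
  choose n d φ using hsplit
  let q : ∀ e : Idem M, k[e.maxSubgroup] ≃ₐ[k] k[e.maxSubgroup] ⧸ Ring.jacobson k[e.maxSubgroup] :=
    fun e => AlgEquiv.ofBijective (Ideal.Quotient.mkₐ k _) ⟨by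
      rw [injective_iff_map_eq_zero]
      intro a ha
      have := Ideal.Quotient.eq_zero_iff_mem.1 ha
      rwa [IsSemisimpleRing.jacobson_eq_bot] at this, Ideal.Quotient.mk_surjective⟩
  let curry : (∀ e : Idem M, ∀ i, Matrix (Fin (d e i)) (Fin (d e i)) k) ≃ₐ[k]
      ∀ p : (Σ e : Idem M, Fin (n e)), Matrix (Fin (d p.1 p.2)) (Fin (d p.1 p.2)) k :=
    { (Equiv.piCurry fun (e : Idem M) (i : Fin (n e)) =>
        Matrix (Fin (d e i)) (Fin (d e i)) k).symm with
      map_mul' := fun _ _ => rfl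
      map_add' := fun _ _ => rfl
      commutes' := fun _ => rfl }
  let ε := Fintype.equivFin (Σ e : Idem M, Fin (n e))
  exact ⟨_, fun j => d (ε.symm j).1 (ε.symm j).2,
    ⟨(Ideal.quotientEquivAlgOfEq k (ker_apexHomPi hM).symm).trans <|
      (Ideal.quotientKerAlgEquivOfSurjective (apexHomPi_surjective hM)).trans <|
      (AlgEquiv.piCongrRight fun e => (q e).trans (φ e).some).trans <|
      curry.trans (AlgEquiv.piCongrLeft' k
        (fun p => Matrix (Fin (d p.1 p.2)) (Fin (d p.1 p.2)) k) ε)⟩⟩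

end Splitting

/-! ### The vertices and the final count of arrows -/

section VertexBijection

variable {k : Type u} [Field k] {M : Type v} [Monoid M] (hM : IsDG M)

/-- The map from the simple modules of the maximal subgroups to the simple modules of `k[M]`. -/
noncomputable def inflateCls (p : Σ e : Idem M, IrrClass k[e.maxSubgroup]) : IrrClass k[M] :=
  Quotient.lift (s := SimpleMod.setoid k[p.1.maxSubgroup]) (fun U => (U.inflate hM).cls)
    (fun U _ h => SimpleMod.cls_eq_iff.2 <|
      ((U.isInflation_inflate hM).of_iso_source h).nonempty_iso
        (SimpleMod.isInflation_inflate hM _)) p.2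

theorem inflateCls_cls_eq_iff (e : Idem M) (U : SimpleMod k[e.maxSubgroup]) (S : SimpleMod k[M]) :
    inflateCls hM ⟨e, U.cls⟩ = S.cls ↔ IsInflation e U S :=
  (SimpleMod.cls_eq_iff (S := U.inflate hM)).trans
    ⟨fun h => (U.isInflation_inflate hM).of_iso h,
      fun h => (U.isInflation_inflate hM).nonempty_iso h⟩

theorem inflateCls_bijective [Finite M] : Function.Bijective (inflateCls (k := k) hM) := by
  constructor
  · rintro ⟨e, U⟩ ⟨e', U'⟩ h
    obtain ⟨U, rfl⟩ := Quotient.exists_rep U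
    obtain ⟨U', rfl⟩ := Quotient.exists_rep U'
    have h1 : IsInflation e U (U'.inflate hM) := (inflateCls_cls_eq_iff hM e U _).1 h
    have h2 := U'.isInflation_inflate hM
    obtain rfl := h1.apex_eq hM h2
    congr 1
    exact SimpleMod.cls_eq_iff.2 (h1.nonempty_iso_source h2)
  · intro S
    obtain ⟨S, rfl⟩ := Quotient.exists_rep S
    obtain ⟨e, U, h⟩ := exists_isInflation hM S
    exact ⟨⟨e, U.cls⟩, (inflateCls_cls_eq_iff hM e U S).2 h⟩

end VertexBijection

theorem finite_chooseBasisIndex_and_card {k V : Type*} [Field k] [AddCommGroup V] [Module k V]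
    (h : Module.Finite k V) : Finite (Module.Free.ChooseBasisIndex k V) ∧
      Nat.card (Module.Free.ChooseBasisIndex k V) = Module.finrank k V :=
  ⟨Module.Finite.finite_basis (Module.Free.chooseBasis k V),
    (Module.finrank_eq_nat_card_basis (Module.Free.chooseBasis k V)).symm⟩

theorem mainTheorem2 {k : Type u} [Field k] {M : Type v} [Monoid M] [Finite M]
    (hM : IsDG M)
    (hsplit : ∀ e : Idem M, SplitsOver k k[e.maxSubgroup])
    (hchar : ∀ e : Idem M, ¬ ringChar k ∣ Nat.card e.maxSubgroup) :
    SplitsOver k k[M] ∧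
    ∃ Φ : (Σ e : Idem M, IrrClass k[e.maxSubgroup]) ≃ GabrielQuiver k k[M],
      (∀ (e : Idem M) (U : SimpleMod k[e.maxSubgroup]) (S : SimpleMod k[M]),
        Φ ⟨e, U.cls⟩ = S.cls ↔ IsInflation e U S) ∧
      ∀ (e f : Idem M) (U : SimpleMod k[e.maxSubgroup]) (V : SimpleMod k[f.maxSubgroup]),
        (tensorDual V.rep U.rep).IsIrreducible ∧
        Finite (Φ ⟨e, U.cls⟩ ⟶ Φ ⟨f, V.cls⟩) ∧
        Nat.card (Φ ⟨e, U.cls⟩ ⟶ Φ ⟨f, V.cls⟩) =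
          constituentMultiplicity k[f.maxSubgroup × e.maxSubgroup]
            (tensorDual V.rep U.rep).asModule (irrPermutationRep k e f).asModule := by
  have : ∀ e : Idem M, NeZero (Nat.card e.maxSubgroup : k) := fun e =>
    ⟨fun h => hchar e ((ringChar.spec k _).1 h)⟩
  refine ⟨splitsOver_monoidAlgebra hM hsplit, Equiv.ofBijective _ (inflateCls_bijective hM),
    inflateCls_cls_eq_iff hM, fun e f U V => ⟨tensorDual_isIrreducible hsplit U V, ?_⟩⟩
  -- Arrows are defined through the representatives chosen by `Quotient.out`; these are again
  -- inflations, since being an inflation is invariant under isomorphism.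
  have hout : ∀ (e : Idem M) (U : SimpleMod k[e.maxSubgroup]),
      IsInflation e U (Quotient.out (s := SimpleMod.setoid k[M]) (inflateCls hM ⟨e, U.cls⟩)) :=
    fun e U => (inflateCls_cls_eq_iff hM e U _).1 (Quotient.out_eq _).symm
  obtain ⟨h1, h2⟩ := extOne_finite_and_finrank_eq hM hsplit hchar (hout e U) (hout f V)
  rw [← h2]
  exact finite_chooseBasisIndex_and_card h1
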